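/- **Theorem 1.3.** Let $M$ be a compact connected affine manifold (a Hausdorff manifold with a distinguished atlas whose transition maps are locally affine) and $L\to M$ an affine $\mathbb{R}$-bundle: it has local trivializations with transition maps $(x,s)\mapsto(x,s+\alpha_{ij}(x))$, $\alpha_{ij}$ locally affine, so that the difference of two points of a fibre is a real number. A section is smooth, affine or (strictly) convex if it is represented by such functions in the trivializations and in the affine coordinates. Assume that $(M,L)$ is Hessian, i.e. $L$ has a smooth section whose second derivative in affine coordinates is positive definite (a Hessian metric). Let $\pi:\Omega\to M$ be the universal covering, $\Pi$ its group of deck transformations, $K=\pi^*L$, and $\Gamma(\Omega,K)$ the finite dimensional affine space of global affine sections of $K$. For a section $\phi$ of $L$ and $q\in\Gamma(\Omega,K)$ put $\Phi_q=\pi^*\phi-q:\Omega\to\mathbb{R}$. Let $K^*\subset\Gamma(\Omega,K)$ be the set of all $q$ for which $\Phi_q$, formed with a Hessian metric in $L$, is bounded from below and proper (this does not depend on the Hessian metric). The group $\mathbb{R}$ acts on $K^*$ by $q\mapsto q+C$, and $\Pi$ by $\gamma.q=\gamma\circ q\circ\gamma^{-1}$; put $\Omega^*=K^*/\mathbb{R}$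 and $M^*=\Omega^*/\Pi$, with the quotient topologies. * For a smooth strictly convex section $\phi$ of $L$ and $x\in M$ one has $d\phi(x)=p$ if, for some $\tilde x\in\Omega$ over $x$, the affine section $q$ tangent to $\pi^*\phi$ at $\tilde x$ lies in $K^*$ and represents $p\in M^*$. * $T_\phi$ is the inverse of $d\phi$: $T_\phi(p)=x$ if, for $q\in K^*$ over $p$, $\Phi_q$ attains its minimum over $\Omega$ at exactly one point, and this point lies over $x$. For a probability measure $\nu$ on $M^*$, $\mathrm{MA}_\nu(\phi)=(T_\phi)_*\nu$. * For $x\in\Omega$ and $p\in\Omega^*$, and any $q\in K^*$ over $p$, let $[x,p]=\sup_{\gamma\in\Pi}(\gamma.q)(x)-q$ and $\phi_0^*(p)=-q+\sup_{z\in\Omega}\,(q(z)-\phi_0(z))$. For a convex section $\phi_0$ of $L$, the formula $c(x,p)=-[x,p]+\phi_0(x)+\phi_0^*(p)$ (in which $q$ cancels) defines a cost function $c:M\times M^*\to\mathbb{R}$. Let $\mu$ and $\nu$ be Borel probability measures on $M$ and $M^*$, let $\phi_0$ be a convex section of $L$ and let $\phi$ be a smooth strictly convex section of $L$ with $\mathrm{MA}_\nu(\phi)=\mu$.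 Then $d\phi:M\to M^*$ is a well-defined map, and it is the optimal transport map for $\mu$, $\nu$ and $c$: it is Borel measurable, $c$ is integrable with respect to every probability measure on $M\times M^*$ with marginals $\mu$ and $\nu$, and $\bar\gamma=(\mathrm{id},d\phi)_*\mu$ has these marginals and is the unique minimizer of $\gamma\mapsto\int_{M\times M^*}c\,d\gamma$ among all such measures. -/

import Mathlib

open Set Filter Topology MeasureTheory
open scoped ContDiff

noncomputable section

namespace HessianTransport

universe u v w t

/-- The model space of affine coordinates, `ℝⁿ`. -/
abbrev Coord (n : ℕ) : Type := EuclideanSpace ℝ (Fin n)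

/-- An affine manifold: a manifold modelled on `ℝⁿ` whose distinguished atlas has (locally) affine
transition maps. -/
class IsAffineManifold (n : ℕ) (M : Type u) [TopologicalSpace M] [ChartedSpace (Coord n) M] :
    Prop where
  transition_affine : ∀ e ∈ atlas (Coord n) M, ∀ e' ∈ atlas (Coord n) M,
    ∀ x ∈ e.source ∩ e'.source,
      ∃ A : Coord n ≃ᵃ[ℝ] Coord n, ∀ᶠ z in 𝓝 x, e' z = A (e z)

/-- Let `π : N → M` be a local homeomorphism to an affine manifold (we use `π = id` and the universal
covering), and give `N` the pulled back affine structure, whose affine coordinates near `y` are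
`chart ∘ π`. This says that `f : N → ℝ` is an affine function of these coordinates near `y`. -/
def IsAffineFunctionAt (n : ℕ) {M : Type u} {N : Type v} [TopologicalSpace M] [TopologicalSpace N]
    [ChartedSpace (Coord n) M] (π : N → M) (f : N → ℝ) (y : N) : Prop :=
  ∃ a : Coord n →ᵃ[ℝ] ℝ, ∀ᶠ z in 𝓝 y, f z = a (chartAt (Coord n) (π y) (π z))

/-- A universal covering `π : Ω → M`: a surjective covering map from a simply connected (in
particular connected and nonempty) space. -/
structure UniversalCovering (M : Type u) [TopologicalSpace M] where
  /-- the covering space `Ω` -/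
  Space : Type t
  [topology : TopologicalSpace Space]
  [simplyConnected : SimplyConnectedSpace Space]
  /-- the covering map `π` -/
  π : Space → M
  isCoveringMap : IsCoveringMap π
  surjective : Function.Surjective π

attribute [instance] UniversalCovering.topology UniversalCovering.simplyConnected

namespace UniversalCovering

variable {M : Type u} [TopologicalSpace M] (P : UniversalCovering.{u, t} M)

/-- The group `Π` of deck transformations of `π : Ω → M`. -/
def deck : Subgroup (P.Space ≃ₜ P.Space) where
  carrier := {γ | ∀ y, P.π (γ y) = P.π y}
  mul_mem' {a b} ha hb y := (ha (b y)).trans (hb y)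
  one_mem' _ := rfl
  inv_mem' {a} ha y := by
    have h := ha (a.symm y)
    rw [a.apply_symm_apply] at h
    exact h.symm

theorem π_inv (γ : P.deck) (y : P.Space) : P.π ((γ⁻¹ : P.deck).1 y) = P.π y := (γ⁻¹).2 y

end UniversalCovering

/-- An affine `ℝ`-bundle `τ = proj : L = Total → M`, given by local trivializations
`y ↦ (proj y, coord i y)` over the sets `base i` of an open cover, with transition maps
`(x, s) ↦ (x, s + transition i j x)` for locally affine functions `transition i j`.
(The affine manifold structure of the total space is the one determined by these
trivializations.) -/
structure AffineRBundle (n : ℕ) (M : Type u) [TopologicalSpace M] [ChartedSpace (Coord n) M] where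
  /-- the total space `L` -/
  Total : Type v
  /-- the projection `τ : L → M` -/
  proj : Total → M
  /-- the index set of the trivializing cover -/
  Index : Type w
  /-- the trivializing open sets -/
  base : Index → Set M
  isOpen_base : ∀ i, IsOpen (base i)
  exists_mem_base : ∀ x, ∃ i, x ∈ base i
  /-- the fibre coordinate of the trivialization over `base i` -/
  coord : Index → Total → ℝ
  bijOn_coord : ∀ i, ∀ x ∈ base i, BijOn (coord i) (proj ⁻¹' {x}) univ
  /-- the transition functions `α i j` -/
  transition : Index → Index → M → ℝ
  coord_eq : ∀ i j y, proj y ∈ base i → proj y ∈ base j →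
    coord i y = coord j y + transition i j (proj y)
  transition_affine : ∀ i j, ∀ x ∈ base i ∩ base j, IsAffineFunctionAt n id (transition i j) x

namespace AffineRBundle

variable {n : ℕ} {M : Type u} [TopologicalSpace M] [ChartedSpace (Coord n) M]
  (L : AffineRBundle.{u, v, w} n M)

/-! ### Differences and translations in the fibres -/

/-- A trivialization around the point `x`. -/
def indexAt (x : M) : L.Index := (L.exists_mem_base x).choose

theorem mem_base_indexAt (x : M) : x ∈ L.base (L.indexAt x) := (L.exists_mem_base x).choose_spec

/-- The fibre coordinate in a trivialization around `x`. -/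
def coordAt (x : M) : L.Total → ℝ := L.coord (L.indexAt x)

/-- The difference `a - b`, a well defined real number, of two points of the same fibre. -/
def diff (a b : L.Total) : ℝ := L.coordAt (L.proj a) a - L.coordAt (L.proj a) b

/-- The difference can be computed in every trivialization. -/
theorem diff_eq {a b : L.Total} (hab : L.proj a = L.proj b) {i : L.Index}
    (hi : L.proj a ∈ L.base i) : L.diff a b = L.coord i a - L.coord i b := by
  have h0 := L.mem_base_indexAt (L.proj a)
  have h1 := L.coord_eq _ i a h0 hi
  have h2 := L.coord_eq _ i b (hab ▸ h0) (hab ▸ hi)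
  rw [← hab] at h2
  unfold diff coordAt
  linarith

theorem exists_translate (c : ℝ) (a : L.Total) :
    ∃ b, L.proj b = L.proj a ∧ L.coordAt (L.proj a) b = c + L.coordAt (L.proj a) a := by
  obtain ⟨b, hb, hb'⟩ := (L.bijOn_coord _ _ (L.mem_base_indexAt (L.proj a))).surjOn
    (mem_univ (c + L.coordAt (L.proj a) a))
  exact ⟨b, hb, hb'⟩

/-- The principal action of `ℝ` on the total space: `a + c` is the point of the fibre of `a` whose
fibre coordinate is that of `a` plus `c`. -/
instance : VAdd ℝ L.Total := ⟨fun c a => (L.exists_translate c a).choose⟩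

theorem proj_vadd (c : ℝ) (a : L.Total) : L.proj (c +ᵥ a) = L.proj a :=
  (L.exists_translate c a).choose_spec.1

theorem diff_vadd_self (c : ℝ) (a : L.Total) : L.diff (c +ᵥ a) a = c := by
  have h : L.coordAt (L.proj a) (c +ᵥ a) = c + L.coordAt (L.proj a) a :=
    (L.exists_translate c a).choose_spec.2
  unfold diff
  rw [L.proj_vadd, h]
  ring

theorem coord_vadd (c : ℝ) (a : L.Total) {i : L.Index} (hi : L.proj a ∈ L.base i) :
    L.coord i (c +ᵥ a) = c + L.coord i a := by
  have h := L.diff_eq (L.proj_vadd c a) (i := i) (by rwa [L.proj_vadd])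
  rw [L.diff_vadd_self] at h
  linarith

theorem ext_coord {a b : L.Total} (hab : L.proj a = L.proj b) {i : L.Index}
    (hi : L.proj a ∈ L.base i) (h : L.coord i a = L.coord i b) : a = b :=
  (L.bijOn_coord i _ hi).injOn rfl hab.symm h

instance : AddAction ℝ L.Total where
  zero_vadd a := by
    have hi := L.mem_base_indexAt (L.proj a)
    refine L.ext_coord (L.proj_vadd 0 a) (i := L.indexAt (L.proj a)) ?_ ?_
    · rwa [L.proj_vadd]
    · rw [L.coord_vadd _ _ hi, zero_add]
  add_vadd c d a := by
    have hi := L.mem_base_indexAt (L.proj a)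
    refine L.ext_coord (i := L.indexAt (L.proj a)) ?_ ?_ ?_
    · rw [L.proj_vadd, L.proj_vadd, L.proj_vadd]
    · rwa [L.proj_vadd]
    · rw [L.coord_vadd _ _ hi, L.coord_vadd _ _ (by rwa [L.proj_vadd]), L.coord_vadd _ _ hi,
        add_assoc]

theorem diff_vadd_right {a b : L.Total} (hab : L.proj a = L.proj b) (c : ℝ) :
    L.diff a (c +ᵥ b) = L.diff a b - c := by
  have hi := L.mem_base_indexAt (L.proj a)
  rw [L.diff_eq (by rw [L.proj_vadd, hab]) hi, L.diff_eq hab hi, L.coord_vadd _ _ (hab ▸ hi)]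
  ring

/-! ### Sections of `L` -/

/-- A section of `L → M`. -/
structure Sec where
  /-- the underlying map `M → L` -/
  toFun : M → L.Total
  proj_toFun : ∀ x, L.proj (toFun x) = x

variable {L}

/-- The function that represents a section in the trivialization `i` and in the affine
coordinates around `x`. -/
def Sec.localRep (φ : L.Sec) (i : L.Index) (x : M) : Coord n → ℝ :=
  fun u => L.coord i (φ.toFun ((chartAt (Coord n) x).symm u))

/-- Smooth sections. -/
def Sec.IsSmooth (φ : L.Sec) : Prop :=
  ∀ i, ∀ x ∈ L.base i, ContDiffAt ℝ ∞ (φ.localRep i x) (chartAt (Coord n) x x)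

/-- Convex sections: in the trivializations, they are represented by functions that are convex in
the affine coordinates. -/
def Sec.IsConvex (φ : L.Sec) : Prop :=
  ∀ i, ∀ x ∈ L.base i, ∃ V ∈ 𝓝 (chartAt (Coord n) x x), ConvexOn ℝ V (φ.localRep i x)

/-- Strictly convex sections. -/
def Sec.IsStrictConvex (φ : L.Sec) : Prop :=
  ∀ i, ∀ x ∈ L.base i, ∃ V ∈ 𝓝 (chartAt (Coord n) x x), StrictConvexOn ℝ V (φ.localRep i x)

/-- A section defines a Hessian metric if it is smooth and its second derivative in affine
coordinates is positive definite. -/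
def Sec.IsHessianMetric (φ : L.Sec) : Prop :=
  φ.IsSmooth ∧ ∀ i, ∀ x ∈ L.base i, ∀ v : Coord n, v ≠ 0 →
    0 < fderiv ℝ (fderiv ℝ (φ.localRep i x)) (chartAt (Coord n) x x) v v

variable (L)

/-- `(M, L)` is a Hessian manifold: `L` is the affine `ℝ`-bundle of some Hessian metric. -/
def IsHessian : Prop := ∃ ψ : L.Sec, ψ.IsHessianMetric

/-! ### Affine sections of `K = π* L` -/

variable (P : UniversalCovering.{u, t} M)

/-- `Γ(Ω, K)`: global affine sections of the pullback `K = {(y, l) | π y = τ l}` of `L` to `Ω`.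
A section of `K` is the same thing as a map `q : Ω → L` with `τ ∘ q = π`. -/
@[ext]
structure AffSec where
  /-- the underlying map `Ω → L` -/
  toFun : P.Space → L.Total
  proj_toFun : ∀ y, L.proj (toFun y) = P.π y
  affine : ∀ i y, P.π y ∈ L.base i → IsAffineFunctionAt n P.π (fun z => L.coord i (toFun z)) y

/-- The topology of the finite dimensional affine space `Γ(Ω, K)`, described as the topology of
pointwise convergence on `Ω`. -/
instance : TopologicalSpace (L.AffSec P) :=
  TopologicalSpace.induced
    (fun (q : L.AffSec P) (y : P.Space) => L.coordAt (P.π y) (q.toFun y)) inferInstance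

variable {L P}

/-- The action of `ℝ` on `Γ(Ω, K)`, `q ↦ q + C`. -/
instance : AddAction ℝ (L.AffSec P) where
  vadd C q :=
    { toFun := fun y => C +ᵥ q.toFun y
      proj_toFun := fun y => by rw [L.proj_vadd, q.proj_toFun]
      affine := fun i y hy => by
        obtain ⟨a, ha⟩ := q.affine i y hy
        refine ⟨AffineMap.const ℝ (Coord n) C + a, ?_⟩
        filter_upwards [ha, P.isCoveringMap.continuous.continuousAt.preimage_mem_nhds
          ((L.isOpen_base i).mem_nhds hy)] with z hz hzi
        rw [L.coord_vadd C _ (by rw [q.proj_toFun]; exact hzi), hz]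
        rfl }
  zero_vadd q := AffSec.ext (funext fun y => zero_vadd ℝ (q.toFun y))
  add_vadd c d q := AffSec.ext (funext fun y => add_vadd c d (q.toFun y))

theorem AffSec.vadd_apply (C : ℝ) (q : L.AffSec P) (y : P.Space) :
    (C +ᵥ q).toFun y = C +ᵥ q.toFun y := rfl

/-- The action of `Π` on `Γ(Ω, K)`, `γ.q = γ ∘ q ∘ γ⁻¹`. As `γ` acts on `K ⊆ Ω × L` by
`γ (y, l) = (γ y, l)`, the map `Ω → L` underlying `γ.q` is that of `q` composed with `γ⁻¹`. -/
instance : MulAction P.deck (L.AffSec P) where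
  smul γ q :=
    { toFun := fun y => q.toFun ((γ⁻¹ : P.deck).1 y)
      proj_toFun := fun y => by rw [q.proj_toFun, P.π_inv]
      affine := fun i y hy => by
        obtain ⟨a, ha⟩ := q.affine i ((γ⁻¹ : P.deck).1 y) (by rwa [P.π_inv])
        refine ⟨a, ?_⟩
        filter_upwards [((γ⁻¹ : P.deck).1.continuous.tendsto y).eventually ha] with z hz
        rw [hz, P.π_inv, P.π_inv] }
  one_smul q := rfl
  mul_smul a b q := by
    refine AffSec.ext (funext fun y => ?_)
    change q.toFun (((a * b)⁻¹ : P.deck).1 y) = q.toFun ((b⁻¹ : P.deck).1 ((a⁻¹ : P.deck).1 y))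
    rw [mul_inv_rev]
    rfl

theorem AffSec.smul_apply (γ : P.deck) (q : L.AffSec P) (y : P.Space) :
    (γ • q).toFun y = q.toFun ((γ⁻¹ : P.deck).1 y) := rfl

/-- The function `Φ_q = π*φ - q` on `Ω`. -/
def Sec.Phi (φ : L.Sec) (q : L.AffSec P) : P.Space → ℝ :=
  fun y => L.diff (φ.toFun (P.π y)) (q.toFun y)

theorem Sec.Phi_vadd (φ : L.Sec) (C : ℝ) (q : L.AffSec P) :
    φ.Phi (C +ᵥ q) = fun y => φ.Phi q y - C :=
  funext fun y => L.diff_vadd_right (by rw [φ.proj_toFun, q.proj_toFun]) C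

theorem Sec.Phi_smul (φ : L.Sec) (γ : P.deck) (q : L.AffSec P) :
    φ.Phi (γ • q) = φ.Phi q ∘ (γ⁻¹ : P.deck).1 := by
  funext y
  change L.diff _ _ = L.diff (φ.toFun (P.π ((γ⁻¹ : P.deck).1 y))) _
  rw [P.π_inv]
  rfl

/-! ### The dual manifold -/

variable (L P)

/-- `K*`: the affine sections `q` for which `Φ_q` is bounded from below and proper. Here `Φ_q` is
formed with a Hessian metric `ψ` in `L`; on a compact `M` the choice of `ψ` does not matter, since two
such functions `Φ_q` differ by a bounded continuous function. -/
def Kstar : Set (L.AffSec P) :=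
  {q | ∃ ψ : L.Sec, ψ.IsHessianMetric ∧ BddBelow (range (ψ.Phi q)) ∧ IsProperMap (ψ.Phi q)}

variable {L P}

theorem vadd_mem_Kstar (C : ℝ) {q : L.AffSec P} (hq : q ∈ L.Kstar P) : C +ᵥ q ∈ L.Kstar P := by
  obtain ⟨ψ, hψ, ⟨m, hm⟩, hp⟩ := hq
  refine ⟨ψ, hψ, ⟨m - C, ?_⟩, ?_⟩
  · rintro _ ⟨y, rfl⟩
    rw [Sec.Phi_vadd]
    exact sub_le_sub_right (hm (mem_range_self y)) C
  · rw [Sec.Phi_vadd]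
    exact (Homeomorph.subRight C).isProperMap.comp hp

theorem smul_mem_Kstar (γ : P.deck) {q : L.AffSec P} (hq : q ∈ L.Kstar P) :
    γ • q ∈ L.Kstar P := by
  obtain ⟨ψ, hψ, ⟨m, hm⟩, hp⟩ := hq
  refine ⟨ψ, hψ, ⟨m, ?_⟩, ?_⟩
  · rintro _ ⟨y, rfl⟩
    rw [Sec.Phi_smul]
    exact hm (mem_range_self _)
  · rw [Sec.Phi_smul]
    exact hp.comp (γ⁻¹ : P.deck).1.isProperMap

instance : AddAction ℝ (L.Kstar P) where
  vadd C q := ⟨C +ᵥ q.1, vadd_mem_Kstar C q.2⟩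
  zero_vadd q := Subtype.ext (zero_vadd ℝ q.1)
  add_vadd c d q := Subtype.ext (add_vadd c d q.1)

instance : MulAction P.deck (L.Kstar P) where
  smul γ q := ⟨γ • q.1, smul_mem_Kstar γ q.2⟩
  one_smul q := Subtype.ext (one_smul P.deck q.1)
  mul_smul a b q := Subtype.ext (mul_smul a b q.1)

variable (L P)

/-- `Ω* = K* / ℝ`, with the quotient topology. -/
abbrev OmegaStar : Type _ := AddAction.orbitRel.Quotient ℝ (L.Kstar P)

variable {L P}

/-- The induced action of `Π` on `Ω*`. -/
instance : MulAction P.deck (L.OmegaStar P) where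
  smul γ := Quotient.map' (fun q => γ • q) (by
    rintro _ q ⟨C, rfl⟩
    exact ⟨C, rfl⟩)
  one_smul p := by
    induction p using Quotient.inductionOn'
    exact congrArg Quotient.mk'' (one_smul P.deck _)
  mul_smul a b p := by
    induction p using Quotient.inductionOn'
    exact congrArg Quotient.mk'' (mul_smul a b _)

variable (L P)

/-- The dual manifold `M* = Ω* / Π`, with the quotient topology. -/
abbrev Mstar : Type _ := MulAction.orbitRel.Quotient P.deck (L.OmegaStar P)

/-- All measures are Borel measures. -/
instance : MeasurableSpace (L.Mstar P) := borel _

instance : BorelSpace (L.Mstar P) := ⟨rfl⟩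

variable {L P}

/-- The point of `M*` under `q ∈ K*`. -/
def toMstar (q : L.Kstar P) : L.Mstar P :=
  Quotient.mk'' (Quotient.mk'' q : L.OmegaStar P)

theorem toMstar_surjective : Function.Surjective (toMstar : L.Kstar P → L.Mstar P) :=
  Quotient.mk''_surjective.comp Quotient.mk''_surjective

/-! ### The map `dφ`, its inverse, and the Monge-Ampère measure -/

/-- The affine section `q` is tangent to `π*φ` at `y`, i.e. `Φ_q y = 0` and `dΦ_q y = 0`: in affine
coordinates around `y`, `Φ_q` vanishes to first order at `y`. -/
def Sec.IsTangentAt (φ : L.Sec) (q : L.AffSec P) (y : P.Space) : Prop :=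
  φ.Phi q =o[𝓝 y] fun z =>
    chartAt (Coord n) (P.π y) (P.π z) - chartAt (Coord n) (P.π y) (P.π y)

/-- `dφ(x) = p`: for a point `y ∈ Ω` over `x`, the affine section tangent to `π*φ` at `y` lies in `K*`
and represents `p ∈ M*`. -/
def Sec.IsDifferentialAt (φ : L.Sec) (x : M) (p : L.Mstar P) : Prop :=
  ∃ y : P.Space, P.π y = x ∧ ∃ q : L.Kstar P, φ.IsTangentAt q.1 y ∧ toMstar q = p

/-- `T_φ(p) = x`, where `T_φ = d(φ*)` is the partially defined inverse of the (in general
multivalued) differential of a convex section: for `q ∈ K*` over `p`, the function `Φ_q` on `Ω` attains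
its minimum at exactly one point, and this point lies over `x`. -/
def Sec.IsInverseDifferentialAt (φ : L.Sec) (p : L.Mstar P) (x : M) : Prop :=
  ∃ q : L.Kstar P, toMstar q = p ∧ ∃ y : P.Space, P.π y = x ∧ ∀ z, z ≠ y → φ.Phi q.1 y < φ.Phi q.1 z

open Classical in
/-- The map `T_φ : M* → M` (with an arbitrary value at the points where it is not defined). -/
def Sec.inverseDifferential (φ : L.Sec) (p : L.Mstar P) : M :=
  if h : ∃ x, φ.IsInverseDifferentialAt p x then h.choose else P.π (Classical.arbitrary P.Space)

/-- The `ν`-Monge-Ampère measure `MA_ν(φ) = (T_φ)_* ν`. -/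
def Sec.mongeAmpere [MeasurableSpace M] (φ : L.Sec) (ν : Measure (L.Mstar P)) : Measure M :=
  ν.map φ.inverseDifferential

/-! ### Legendre transform, pairing and cost function -/

/-- The Legendre transform. The section `φ*(p) = -q + sup (q - φ)` of `-K* → Ω*` is represented by the
function `q ↦ φ*(p) + q = sup (q - φ)` on `K*`. -/
def Sec.legendre (φ : L.Sec) (q : L.AffSec P) : ℝ := ⨆ z : P.Space, L.diff (q.toFun z) (φ.toFun (P.π z))

/-- The pairing. The section `[y, p] = sup_γ (γ.q)(y) - q` of `K ⊞ -K*` is represented by the point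
`[y, p] + q = sup_γ (γ.q)(y)` in the fibre of `K` over `y`, for `q ∈ K*` over `p`; the supremum in this
fibre is computed relative to its point `q y`. -/
def pairing (y : P.Space) (q : L.AffSec P) : L.Total :=
  (⨆ γ : P.deck, L.diff ((γ • q).toFun y) (q.toFun y)) +ᵥ q.toFun y

/-- The number `-[y, p] + φ₀(y) + φ₀*(p) = -(([y, p] + q) - φ₀(y)) + (φ₀*(p) + q)`, for `y ∈ Ω` and
`q ∈ K*` over `p`. -/
def Sec.coverCost (φ₀ : L.Sec) (y : P.Space) (q : L.AffSec P) : ℝ :=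
  -L.diff (pairing y q) (φ₀.toFun (P.π y)) + φ₀.legendre q

/-- The cost function `c(x, p) = -[x, p] + φ₀(x) + φ₀*(p)` on `M × M*`, computed with representatives of
`x` in `Ω` and of `p` in `K*`; it does not depend on them. -/
def Sec.cost (φ₀ : L.Sec) (x : M) (p : L.Mstar P) : ℝ :=
  φ₀.coverCost (Function.surjInv P.surjective x) (Function.surjInv toMstar_surjective p).1

end AffineRBundle

/-! ### Optimal transport -/

section OptimalTransport

variable {X : Type u} {Y : Type v} [MeasurableSpace X] [MeasurableSpace Y]

/-- Transport plans: probability measures on `X × Y` with marginals `μ` and `ν`. -/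
def IsTransportPlan (μ : Measure X) (ν : Measure Y) (ρ : Measure (X × Y)) : Prop :=
  IsProbabilityMeasure ρ ∧ ρ.map Prod.fst = μ ∧ ρ.map Prod.snd = ν

/-- The transport plan `ρ` minimizes `I_c(ρ) = ∫ c dρ`. -/
def IsOptimalPlan (c : X → Y → ℝ) (μ : Measure X) (ν : Measure Y) (ρ : Measure (X × Y)) : Prop :=
  IsTransportPlan μ ν ρ ∧
    ∀ ρ', IsTransportPlan μ ν ρ' → ∫ z, c z.1 z.2 ∂ρ ≤ ∫ z, c z.1 z.2 ∂ρ'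

/-- `T` is the optimal transport map for `μ`, `ν` and `c`: the cost of every transport plan is finite,
and the plan `(id, T)_* μ`, which is supported on the graph of `T`, is the (unique) minimizer of
`I_c`. -/
structure IsOptimalTransportMap (c : X → Y → ℝ) (μ : Measure X) (ν : Measure Y) (T : X → Y) :
    Prop where
  measurable : Measurable T
  integrable : ∀ ρ, IsTransportPlan μ ν ρ → Integrable (fun z : X × Y => c z.1 z.2) ρ
  optimal : IsOptimalPlan c μ ν (μ.map fun x => (x, T x))
  unique : ∀ ρ, IsOptimalPlan c μ ν ρ → ρ = μ.map fun x => (x, T x)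

end OptimalTransport

end HessianTransport

end

open HessianTransport

open Set Filter Topology MeasureTheory
open scoped ContDiff

noncomputable section

namespace HessianTransport

universe u v w t

/-! ### Locally strictly convex functions -/

/-! The cost splits as a nonnegative function plus two potentials (`cost_eq`). If `q` is tangent to
`π*φ` over `x'`, let `gap (x, x')` be the infimum of `Φ_q` over the fibre of `x`. Then `c(x, p)` is
`gap (x, T_φ p)`, plus the function `φ₀ - φ` of `x`, plus a function of `p`. The gap is nonnegative
and vanishes exactly for `x = x'` (`gap_eq_zero_iff`). All plans give the potentials the same
integral. The minimizers are therefore the plans concentrated on `x = T_φ p`, which is the graph of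
`dφ`, and such a plan is determined by its marginal `μ` (`isOptimalTransportMap_of_potentials`).
Since `dφ ∘ T_φ = id`, the Monge-Ampère equation turns into `dφ_* μ = ν`.

The substance lies in showing that `dφ` and `T_φ` are everywhere defined, mutually inverse and
continuous. The affine section `q` tangent at any `y ∈ Ω` must lie in `K*`, with `Φ_q` positive away
from `y`, although the developing map `D` is a priori neither injective nor onto a convex set. One
therefore works on the star-shaped set of points visible from `y` along straight rays (`starExp`).
Strict convexity along rays gives positivity and linear growth there. Compactness of `M` and
invariance under deck transformations give a uniform convexity gap (`uniformlyMidpointConvex`), so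
that a ray cannot run out of `Ω` while `Φ_q` stays bounded (`mem_star_of_mem_closure`). By
connectedness every point of `Ω` is visible (`starExp_left_inv`), and `Φ_q` has compact sublevel
sets. Conversely, for `q ∈ K*` the function `Φ_q` has a minimum, and there `q` is tangent up to a
constant. These facts form `exists_isTangentFamily`.

The affine sections and the developing map come from lifting `π` to the covering of germs of affine
sections of `L` (`exists_affSec`, `exists_isDeveloping`). -/

theorem lt_mul_of_locally_midpoint_convex {F : ℝ → ℝ} (hc : ContinuousOn F (Icc 0 1)) (h0 : F 0 = 0)
    (hF : ∀ t ∈ Ioo (0 : ℝ) 1, ∀ᶠ h in 𝓝[>] (0 : ℝ), 2 * F t < F (t - h) + F (t + h))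
    {t : ℝ} (ht : t ∈ Ioo (0 : ℝ) 1) : F t < t * F 1 := by
  set g : ℝ → ℝ := fun s => F s - s * F 1 with hg
  have hgc : ContinuousOn g (Icc 0 1) := by fun_prop
  -- Subtracting the chord keeps the strict midpoint inequality, so `g` has no interior maximum. As
  -- `g` vanishes at both ends, it is negative in between.
  have key : ∀ s ∈ Ioo (0 : ℝ) 1, ¬ ∀ r ∈ Icc (0 : ℝ) 1, g r ≤ g s := by
    intro s hs hmax
    have h1 : ∀ᶠ h in 𝓝[>] (0 : ℝ), h ∈ Ioo 0 (min s (1 - s)) :=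
      Ioo_mem_nhdsGT (lt_min hs.1 (sub_pos.2 hs.2))
    obtain ⟨h, h2, h3⟩ := ((hF s hs).and h1).exists
    have h4 := h3.2.trans_le (min_le_left _ _)
    have h5 := h3.2.trans_le (min_le_right _ _)
    have h6 := hmax (s - h) ⟨by linarith, by linarith [h3.1, hs.2]⟩
    have h7 := hmax (s + h) ⟨by linarith [h3.1, hs.1], by linarith⟩
    simp only [hg] at h6 h7
    nlinarith
  obtain ⟨s, hs, hsmax⟩ := isCompact_Icc.exists_isMaxOn ⟨0, by simp⟩ hgc
  have hs0 : g s = 0 := by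
    by_contra hne
    refine key s ⟨lt_of_le_of_ne hs.1 ?_, lt_of_le_of_ne hs.2 ?_⟩ fun r hr => hsmax hr
    · rintro rfl; simp [hg, h0] at hne
    · rintro rfl; simp [hg] at hne
  by_contra hcon
  refine key t ht fun r hr => (hsmax hr).trans ?_
  rw [hs0]
  simp only [hg]
  linarith

theorem _root_.StrictConvexOn.two_mul_lt {E : Type*} [AddCommGroup E] [Module ℝ E] {G : E → ℝ}
    {s : Set E} (hG : StrictConvexOn ℝ s G) {u v : E} (hm : u - v ∈ s) (hp : u + v ∈ s)
    (hv : v ≠ 0) : 2 * G u < G (u - v) + G (u + v) := by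
  have hne : u - v ≠ u + v := by
    intro hcon
    have h2 : (2 : ℝ) • v = 0 := by
      rw [two_smul]
      have := sub_eq_zero.2 hcon.symm
      simpa [add_sub_sub_cancel] using this
    exact hv ((smul_eq_zero.1 h2).resolve_left two_ne_zero)
  have := hG.2 hm hp hne (show (0 : ℝ) < 1 / 2 by norm_num) (show (0 : ℝ) < 1 / 2 by norm_num)
    (by norm_num)
  rw [← smul_add, show u - v + (u + v) = (2 : ℝ) • u by rw [two_smul]; abel, smul_smul] at this
  norm_num at this
  linarith

theorem eventually_midpoint_lt {E : Type*} [NormedAddCommGroup E] [NormedSpace ℝ E] {G : E → ℝ}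
    {u v : E} {ε : ℝ} (hε : 0 < ε) (hG : StrictConvexOn ℝ (Metric.ball u ε) G) (hv : v ≠ 0) :
    ∀ᶠ h in 𝓝[>] (0 : ℝ), 2 * G u < G (u - h • v) + G (u + h • v) := by
  have hlim : ∀ᶠ h in 𝓝 (0 : ℝ), ‖h • v‖ < ε := by
    have : Tendsto (fun h : ℝ => ‖h • v‖) (𝓝 0) (𝓝 0) := by
      have : Continuous fun h : ℝ => ‖h • v‖ := by fun_prop
      simpa using this.tendsto 0
    exact this.eventually_lt_const hε
  filter_upwards [nhdsWithin_le_nhds hlim, self_mem_nhdsWithin] with h hh (h0 : 0 < h)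
  exact hG.two_mul_lt (by simpa [Metric.mem_ball, dist_eq_norm] using hh)
    (by simpa [Metric.mem_ball, dist_eq_norm] using hh) (smul_ne_zero h0.ne' hv)

/-- The filter `𝓝 y` contains the condition at `y` itself, where the right-hand side is zero. Thus
the little-o hypothesis encodes the vanishing of both the value and the differential. -/
theorem apply_eq_zero_of_isLittleO {Ω E : Type*} [TopologicalSpace Ω] [NormedAddCommGroup E]
    {D : Ω → E} {f : Ω → ℝ} {y : Ω} (hcrit : f =o[𝓝 y] fun z => D z - D y) : f y = 0 := by
  simpa using (hcrit.def one_pos).self_of_nhds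

/-! ### Sections of local homeomorphisms to a vector space -/

section Star

variable {Ω : Type*} [TopologicalSpace Ω] {E : Type*} [NormedAddCommGroup E] [NormedSpace ℝ E]

/-- `s` is a continuous section of `D` over the open convex set `C`, with value `y` at `D y`. -/
structure IsConvexSection (D : Ω → E) (y : Ω) (C : Set E) (s : E → Ω) : Prop where
  isOpen : IsOpen C
  convex : Convex ℝ C
  mem : D y ∈ C
  continuousOn : ContinuousOn s C
  apply_self : s (D y) = y
  right_inv : ∀ u ∈ C, D (s u) = u

/-- The points which are visible from `y` through `D`. -/
def starDomain (D : Ω → E) (y : Ω) : Set E := {u | ∃ C s, IsConvexSection D y C s ∧ u ∈ C}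

open Classical in
/-- The exponential map: the maximal section of `D` with value `y` at `D y`, over a star shaped set. -/
def starExp (D : Ω → E) (y : Ω) (u : E) : Ω :=
  if h : ∃ C s, IsConvexSection D y C s ∧ u ∈ C then h.choose_spec.choose u else y

/-- In suitable affine coordinates around `y`, the function `f` is midpoint convex on the unit sphere
around `y`, with the gap `δ`. -/
def MidpointGap (D : Ω → E) (f : Ω → ℝ) (δ : ℝ) (y : Ω) : Prop :=
  ∃ (A : E ≃ₗ[ℝ] E) (W : Set E) (s : E → Ω), IsConvexSection D y W s ∧
    ∀ w, ‖w‖ = 1 → D y + A w ∈ W ∧ D y - A w ∈ W ∧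
      2 * f y + 2 * δ ≤ f (s (D y + A w)) + f (s (D y - A w))

/-- The function `f` is midpoint convex with a uniform gap, in suitable affine coordinates around
each point. -/
def UniformlyMidpointConvex (D : Ω → E) (f : Ω → ℝ) : Prop :=
  ∃ δ : ℝ, 0 < δ ∧ ∀ y, MidpointGap D f δ y

/-- Near each point, `f` is a strictly convex function of `D`. -/
def LocallyStrictConvex (D : Ω → E) (f : Ω → ℝ) : Prop :=
  ∀ y, ∃ G : E → ℝ, (∃ ε > 0, StrictConvexOn ℝ (Metric.ball (D y) ε) G) ∧
    ∀ᶠ z in 𝓝 y, f z = G (D z)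

variable {D : Ω → E} {y : Ω} {f : Ω → ℝ}

theorem _root_.IsLocalHomeomorph.exists_isConvexSection (hD : IsLocalHomeomorph D) (y : Ω) :
    ∃ C s, IsConvexSection D y C s := by
  obtain ⟨e, hy, rfl⟩ := hD y
  obtain ⟨ε, hε, hb⟩ := Metric.isOpen_iff.1 e.open_target (e y) (e.map_source hy)
  exact ⟨Metric.ball (e y) ε, e.symm, Metric.isOpen_ball, convex_ball _ _, Metric.mem_ball_self hε,
    e.continuousOn_symm.mono hb, e.left_inv hy, fun u hu => e.right_inv (hb hu)⟩

/-- Uniqueness of lifts: the intersection of the domains is convex, hence connected, `Ω` is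
Hausdorff and `D` is locally injective. -/
theorem IsConvexSection.eqOn [T2Space Ω] (hD : IsLocalHomeomorph D) {y' : Ω} {C C' : Set E}
    {s s' : E → Ω} (h : IsConvexSection D y C s) (h' : IsConvexSection D y' C' s') {u : E}
    (hu : u ∈ C ∩ C') (huu : s u = s' u) : EqOn s s' (C ∩ C') :=
  (T2Space.isSeparatedMap D).eqOn_of_comp_eqOn hD.isLocallyInjective
    (h.convex.inter h'.convex).isPreconnected (h.continuousOn.mono inter_subset_left)
    (h'.continuousOn.mono inter_subset_right)
    (fun v hv => (h.right_inv v hv.1).trans (h'.right_inv v hv.2).symm) hu huu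

theorem isOpen_starDomain : IsOpen (starDomain D y) := by
  rw [isOpen_iff_mem_nhds]
  rintro u ⟨C, s, h, hu⟩
  filter_upwards [h.isOpen.mem_nhds hu] with v hv using ⟨C, s, h, hv⟩

theorem IsConvexSection.subset_star {C : Set E} {s : E → Ω} (h : IsConvexSection D y C s) :
    C ⊆ starDomain D y := fun _ hu => ⟨C, s, h, hu⟩

theorem apply_mem_starDomain (hD : IsLocalHomeomorph D) : D y ∈ starDomain D y := by
  obtain ⟨C, s, h⟩ := hD.exists_isConvexSection y
  exact h.subset_star h.mem

theorem IsConvexSection.add_smul_mem {C : Set E} {s : E → Ω} (h : IsConvexSection D y C s) {v : E}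
    {r : ℝ} (hr : D y + r • v ∈ C) {t : ℝ} (ht : t ∈ Icc 0 r) : D y + t • v ∈ C := by
  rcases ht.1.eq_or_lt with rfl | ht0
  · simpa using h.mem
  · have hr0 := ht0.trans_le ht.2
    have := h.convex.add_smul_sub_mem h.mem hr (t := t / r)
      ⟨div_nonneg ht.1 hr0.le, div_le_one_of_le₀ ht.2 hr0.le⟩
    simpa [smul_smul, div_mul_cancel₀ _ hr0.ne'] using this

theorem star_segment {v : E} {r : ℝ} (hr : D y + r • v ∈ starDomain D y) {t : ℝ} (ht : t ∈ Icc 0 r) :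
    D y + t • v ∈ starDomain D y := by
  obtain ⟨C, s, h, hu⟩ := hr
  exact h.subset_star (h.add_smul_mem hu ht)

variable [T2Space Ω]

/-- `starExp` chooses a section separately at each point. Uniqueness of sections shows that the
choice does not matter, so it inherits continuity and the section property. -/
theorem IsConvexSection.starExp_eq (hD : IsLocalHomeomorph D) {C : Set E} {s : E → Ω}
    (h : IsConvexSection D y C s) {u : E} (hu : u ∈ C) : starExp D y u = s u := by
  have hex : ∃ C s, IsConvexSection D y C s ∧ u ∈ C := ⟨C, s, h, hu⟩
  rw [starExp, dif_pos hex]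
  obtain ⟨h1, h2⟩ := hex.choose_spec.choose_spec
  exact h1.eqOn hD h ⟨h1.mem, h.mem⟩ (h1.apply_self.trans h.apply_self.symm) ⟨h2, hu⟩

theorem starExp_apply_self (hD : IsLocalHomeomorph D) : starExp D y (D y) = y := by
  obtain ⟨C, s, h⟩ := hD.exists_isConvexSection y
  rw [h.starExp_eq hD h.mem, h.apply_self]

theorem starExp_right_inv (hD : IsLocalHomeomorph D) {u : E} (hu : u ∈ starDomain D y) :
    D (starExp D y u) = u := by
  obtain ⟨C, s, h, huC⟩ := hu
  rw [h.starExp_eq hD huC, h.right_inv u huC]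

theorem continuousOn_starExp (hD : IsLocalHomeomorph D) :
    ContinuousOn (starExp D y) (starDomain D y) := by
  rintro u ⟨C, s, h, hu⟩
  refine ContinuousAt.continuousWithinAt ?_
  refine (h.continuousOn.continuousAt (h.isOpen.mem_nhds hu)).congr ?_
  filter_upwards [h.isOpen.mem_nhds hu] with v hv using (h.starExp_eq hD hv).symm

/-- A ray which ends in a convex section around one of its points can be continued. -/
theorem star_extend (hD : IsLocalHomeomorph D) {v : E} {t r : ℝ} (ht : 0 ≤ t) (htr : t ≤ r)
    (hv : D y + t • v ∈ starDomain D y) {W : Set E} {s : E → Ω}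
    (hW : IsConvexSection D (starExp D y (D y + t • v)) W s) (hr : D y + r • v ∈ W) :
    D y + r • v ∈ starDomain D y := by
  obtain ⟨C, s₀, h, hu⟩ := hv
  have hz := h.starExp_eq hD hu
  have hDz : D (starExp D y (D y + t • v)) = D y + t • v := by rw [hz, h.right_inv _ hu]
  have hmW : D y + t • v ∈ W := by simpa only [hDz] using hW.mem
  have hag : EqOn s₀ s (C ∩ W) := by
    refine h.eqOn hD hW ⟨hu, hmW⟩ ?_
    rw [← hz]
    simpa only [hDz] using hW.apply_self.symm
  -- The segment lies in `C` up to the parameter `t` and in `W` afterwards.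
  have hseg : segment ℝ (D y) (D y + r • v) ⊆ C ∪ W := by
    rw [segment_eq_image']
    rintro _ ⟨τ, hτ, rfl⟩
    simp only [add_sub_cancel_left, smul_smul]
    rcases le_total (τ * r) t with hle | hle
    · left
      exact h.add_smul_mem hu ⟨mul_nonneg hτ.1 (ht.trans htr), hle⟩
    · right
      have hτr : τ * r ≤ r := mul_le_of_le_one_left (ht.trans htr) hτ.2
      rcases htr.eq_or_lt with rfl | htr0
      · rwa [le_antisymm hτr hle]
      · have := hW.convex.add_smul_sub_mem hmW hr (t := (τ * r - t) / (r - t))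
          ⟨div_nonneg (by linarith) (by linarith), div_le_one_of_le₀ (by linarith) (by linarith)⟩
        rw [add_sub_add_left_eq_sub, ← sub_smul, smul_smul, div_mul_cancel₀ _ (by linarith), add_assoc,
          ← add_smul] at this
        simpa using this
  have hcomp : IsCompact (segment ℝ (D y) (D y + r • v)) := by
    rw [segment_eq_image']
    exact isCompact_Icc.image (by fun_prop)
  -- A thickening of a segment is open and convex, so it can serve as the domain of the section
  -- glued from `s₀` and `s`.
  obtain ⟨ε, hε, hth⟩ := hcomp.exists_thickening_subset_open (h.isOpen.union hW.isOpen) hseg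
  classical
  refine ⟨_, fun u => if u ∈ C then s₀ u else s u, ⟨Metric.isOpen_thickening,
    (convex_segment _ _).thickening ε, Metric.self_subset_thickening hε _ (left_mem_segment ..),
    ?_, ?_, ?_⟩, Metric.self_subset_thickening hε _ (right_mem_segment ..)⟩
  · intro u hu
    refine ContinuousAt.continuousWithinAt ?_
    by_cases huC : u ∈ C
    · refine (h.continuousOn.continuousAt (h.isOpen.mem_nhds huC)).congr ?_
      filter_upwards [h.isOpen.mem_nhds huC] with z hz using (if_pos hz).symm
    · have huW : u ∈ W := (hth hu).resolve_left huC
      refine (hW.continuousOn.continuousAt (hW.isOpen.mem_nhds huW)).congr ?_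
      filter_upwards [hW.isOpen.mem_nhds huW] with z hz
      split_ifs with hzC
      · exact (hag ⟨hzC, hz⟩).symm
      · rfl
  · rw [if_pos h.mem, h.apply_self]
  · intro u hu
    split_ifs with huC
    · exact h.right_inv u huC
    · exact hW.right_inv u ((hth hu).resolve_left huC)

/-- Allows the values of `f` in a convex section around a point of the ray to be read as values
along the ray, on both sides of that point. -/
theorem starExp_eq_of_mem (hD : IsLocalHomeomorph D) {v : E} {R : ℝ}
    (hv : D y + R • v ∈ starDomain D y) {t : ℝ} (ht : t ∈ Icc 0 R) {r : ℝ} (hr : r ∈ Icc 0 R)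
    {W : Set E} {s : E → Ω}
    (hW : IsConvexSection D (starExp D y (D y + t • v)) W s) (hrW : D y + r • v ∈ W) :
    starExp D y (D y + r • v) = s (D y + r • v) := by
  obtain ⟨C, s₀, h, hu⟩ := hv
  have hmem : ∀ τ ∈ Icc 0 R, D y + τ • v ∈ C := fun τ hτ => h.add_smul_mem hu hτ
  have hz := h.starExp_eq hD (hmem t ht)
  have hDz : D (starExp D y (D y + t • v)) = D y + t • v := by rw [hz, h.right_inv _ (hmem t ht)]
  have hmW : D y + t • v ∈ W := by simpa only [hDz] using hW.mem
  rw [h.starExp_eq hD (hmem r hr)]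
  refine h.eqOn hD hW ⟨hmem t ht, hmW⟩ ?_ ⟨hmem r hr, hrW⟩
  rw [← hz]
  simpa only [hDz] using hW.apply_self.symm

/-! ### Growth of locally strictly convex functions -/

/-- Along the ray `f` is a continuous function of one variable which near each interior point equals
a strictly convex function, so the one-variable maximum principle applies. -/
theorem apply_starExp_smul_lt (hD : IsLocalHomeomorph D) (hc : Continuous f)
    (hf : LocallyStrictConvex D f) (h0 : f y = 0) {v : E} (hv : D y + v ∈ starDomain D y) (hv0 : v ≠ 0)
    {t : ℝ} (ht : t ∈ Ioo (0 : ℝ) 1) :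
    f (starExp D y (D y + t • v)) < t * f (starExp D y (D y + v)) := by
  have hv1 : D y + (1 : ℝ) • v ∈ starDomain D y := by rwa [one_smul]
  have hcont : ContinuousOn (fun r : ℝ => f (starExp D y (D y + r • v))) (Icc 0 1) :=
    hc.comp_continuousOn ((continuousOn_starExp hD).comp (by fun_prop)
      fun r hr => star_segment hv1 hr)
  have := lt_mul_of_locally_midpoint_convex hcont (by simpa [starExp_apply_self hD] using h0)
    (fun r hr => ?_) ht
  · simpa using this
  · have hrs := star_segment hv1 (Ioo_subset_Icc_self hr)
    obtain ⟨G, ⟨ε, hε, hG⟩, hfG⟩ := hf (starExp D y (D y + r • v))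
    rw [starExp_right_inv hD hrs] at hG
    have hex : ∀ᶠ u in 𝓝 (D y + r • v), f (starExp D y u) = G u := by
      filter_upwards [((continuousOn_starExp hD).continuousAt
        (isOpen_starDomain.mem_nhds hrs)).eventually hfG, isOpen_starDomain.mem_nhds hrs] with u hu hus
      rw [hu, starExp_right_inv hD hus]
    have h1 : Tendsto (fun h : ℝ => D y + (r - h) • v) (𝓝[>] 0) (𝓝 (D y + r • v)) := by
      have : Continuous fun h : ℝ => D y + (r - h) • v := by fun_prop
      simpa using (this.tendsto 0).mono_left nhdsWithin_le_nhds
    have h2 : Tendsto (fun h : ℝ => D y + (r + h) • v) (𝓝[>] 0) (𝓝 (D y + r • v)) := by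
      have : Continuous fun h : ℝ => D y + (r + h) • v := by fun_prop
      simpa using (this.tendsto 0).mono_left nhdsWithin_le_nhds
    filter_upwards [h1.eventually hex, h2.eventually hex, eventually_midpoint_lt hε hG hv0]
      with h h3 h4 h5
    rw [h3, h4, hex.self_of_nhds]
    simpa [add_smul, sub_smul, add_assoc, add_sub_assoc] using h5

/-- Criticality gives `f ≥ -c t` at small parameters `t` of the ray, for every `c > 0`. The ray
inequality bounds the same value by `t` times the value at the end, which is thus at least `-c`. -/
theorem apply_starExp_nonneg (hD : IsLocalHomeomorph D) (hc : Continuous f)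
    (hf : LocallyStrictConvex D f) (hcrit : f =o[𝓝 y] fun z => D z - D y) {u : E}
    (hu : u ∈ starDomain D y) : 0 ≤ f (starExp D y u) := by
  have h0 := apply_eq_zero_of_isLittleO hcrit
  obtain ⟨v, rfl⟩ : ∃ v, u = D y + v := ⟨u - D y, by abel⟩
  rcases eq_or_ne v 0 with rfl | hv
  · simp [starExp_apply_self hD, h0]
  have hv1 : D y + (1 : ℝ) • v ∈ starDomain D y := by rwa [one_smul]
  have htend : Tendsto (fun t : ℝ => starExp D y (D y + t • v)) (𝓝 0) (𝓝 y) := by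
    have h1 : Tendsto (fun t : ℝ => D y + t • v) (𝓝 0) (𝓝 (D y)) := by
      have : Continuous fun t : ℝ => D y + t • v := by fun_prop
      simpa using this.tendsto 0
    have h2 := (continuousOn_starExp hD).continuousAt (isOpen_starDomain.mem_nhds (apply_mem_starDomain (y := y) hD))
    rw [ContinuousAt, starExp_apply_self hD] at h2
    exact h2.comp h1
  refine le_of_forall_pos_le_add fun c hcpos => ?_
  have hv' := norm_pos_iff.2 hv
  have h3 := (htend.eventually (hcrit.def (div_pos hcpos hv'))).filter_mono
    (nhdsWithin_le_nhds (s := Ioi 0))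
  obtain ⟨t, ht, ht'⟩ := (h3.and (Ioo_mem_nhdsGT (zero_lt_one' ℝ))).exists
  have h4 := apply_starExp_smul_lt hD hc hf h0 hu hv ht'
  rw [starExp_right_inv hD (star_segment hv1 (Ioo_subset_Icc_self ht')), add_sub_cancel_left,
    norm_smul, Real.norm_eq_abs, Real.norm_eq_abs, abs_of_pos ht'.1, mul_left_comm,
    div_mul_cancel₀ _ hv'.ne'] at ht
  have h5 := (neg_le_of_abs_le ht).trans_lt h4
  have h6 : t * (-c) < t * f (starExp D y (D y + v)) := by linarith
  linarith [lt_of_mul_lt_mul_left h6 ht'.1.le]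

/-- The value at the end of the ray exceeds twice the value at its midpoint, which is nonnegative.
-/
theorem apply_starExp_pos (hD : IsLocalHomeomorph D) (hc : Continuous f)
    (hf : LocallyStrictConvex D f) (hcrit : f =o[𝓝 y] fun z => D z - D y) {u : E}
    (hu : u ∈ starDomain D y) (hne : u ≠ D y) : 0 < f (starExp D y u) := by
  obtain ⟨v, rfl⟩ : ∃ v, u = D y + v := ⟨u - D y, by abel⟩
  have hv : v ≠ 0 := by rintro rfl; simp at hne
  have h1 := apply_starExp_smul_lt hD hc hf (apply_eq_zero_of_isLittleO hcrit) hu hv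
    (t := 1 / 2) (by norm_num)
  have h2 := apply_starExp_nonneg hD hc hf hcrit (u := D y + (1 / 2 : ℝ) • v)
    (star_segment (r := 1) (by rwa [one_smul]) (by norm_num))
  linarith

theorem apply_starExp_mono (hD : IsLocalHomeomorph D) (hc : Continuous f)
    (hf : LocallyStrictConvex D f) (hcrit : f =o[𝓝 y] fun z => D z - D y) {v : E} {r : ℝ}
    (hv : D y + r • v ∈ starDomain D y) {t : ℝ} (ht : t ∈ Icc 0 r) :
    f (starExp D y (D y + t • v)) ≤ f (starExp D y (D y + r • v)) := by
  have h0 := apply_eq_zero_of_isLittleO hcrit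
  have hpos := apply_starExp_nonneg hD hc hf hcrit hv
  rcases eq_or_ne v 0 with rfl | hv0
  · simp
  rcases ht.1.eq_or_lt with rfl | ht0
  · simpa [starExp_apply_self hD, h0] using hpos
  rcases ht.2.eq_or_lt with rfl | htr
  · rfl
  have hr0 := ht0.trans htr
  have := apply_starExp_smul_lt hD hc hf h0 hv (smul_ne_zero hr0.ne' hv0) (t := t / r)
    ⟨div_pos ht0 hr0, (div_lt_one hr0).2 htr⟩
  rw [smul_smul, div_mul_cancel₀ _ hr0.ne'] at this
  exact this.le.trans (mul_le_of_le_one_left hpos (div_le_one_of_le₀ ht.2 hr0.le))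

/-- The place where uniform convexity replaces completeness. If the ray to `u` left the star at a
time `T`, then `f` would be bounded on it before `T`. But a uniform gap forces `f` to rise by a
fixed amount over one step near `T`, unless the step passes `T`, and then the ray can be continued.
-/
theorem mem_star_of_mem_closure (hD : IsLocalHomeomorph D) (hc : Continuous f)
    (hf : LocallyStrictConvex D f) (hu : UniformlyMidpointConvex D f)
    (hcrit : f =o[𝓝 y] fun z => D z - D y) {c : ℝ} {u : E}
    (huc : u ∈ closure {u ∈ starDomain D y | f (starExp D y u) ≤ c}) : u ∈ starDomain D y := by
  obtain ⟨δ, hδ, hU⟩ := hu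
  obtain ⟨v, rfl⟩ : ∃ v, u = D y + v := ⟨u - D y, by abel⟩
  set F : ℝ → ℝ := fun t => f (starExp D y (D y + t • v)) with hF
  have hbound : ∀ t ∈ Icc (0 : ℝ) 1, D y + t • v ∈ starDomain D y → F t ≤ c := by
    intro t ht hts
    by_contra! hlt
    have h1 : ∀ᶠ u in 𝓝 (D y + t • v), c < f (starExp D y u) :=
      ((hc.continuousAt.comp ((continuousOn_starExp hD).continuousAt
        (isOpen_starDomain.mem_nhds hts))).eventually_const_lt hlt)
    have h2 : Tendsto (fun u => D y + t • (u - D y)) (𝓝 (D y + v)) (𝓝 (D y + t • v)) := by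
      have : Continuous fun u : E => D y + t • (u - D y) := by fun_prop
      simpa using this.tendsto (D y + v)
    obtain ⟨u, ⟨hu1, hu2⟩, hu3⟩ :=
      ((mem_closure_iff_frequently.1 huc).and_eventually (h2.eventually h1)).exists
    have h4 := apply_starExp_mono hD hc hf hcrit (v := u - D y) (r := 1) (by simpa using hu1) ht
    rw [one_smul, add_sub_cancel] at h4
    linarith
  by_contra hns
  set J : Set ℝ := {t ∈ Icc (0 : ℝ) 1 | D y + t • v ∈ starDomain D y} with hJ
  have hJ0 : (0 : ℝ) ∈ J := ⟨by simp, by simpa using apply_mem_starDomain hD⟩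
  have hJb : BddAbove J := ⟨1, fun t ht => ht.1.2⟩
  set T := sSup J
  have hT0 : 0 ≤ T := le_csSup hJb hJ0
  have hT1 : T ≤ 1 := csSup_le ⟨0, hJ0⟩ fun t ht => ht.1.2
  have hTJ : D y + T • v ∉ starDomain D y := by
    intro hT
    have hTne : T ≠ 1 := by
      intro h
      rw [h, one_smul] at hT
      exact hns hT
    have h1 : ∀ᶠ t in 𝓝 T, D y + t • v ∈ starDomain D y := by
      have : Continuous fun t : ℝ => D y + t • v := by fun_prop
      exact this.continuousAt.preimage_mem_nhds (isOpen_starDomain.mem_nhds hT)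
    obtain ⟨t, ht, ht'⟩ := ((h1.filter_mono (nhdsWithin_le_nhds (s := Ioi T))).and
      (Ioo_mem_nhdsGT (lt_of_le_of_ne hT1 hTne))).exists
    exact absurd (le_csSup hJb ⟨⟨hT0.trans ht'.1.le, ht'.2.le⟩, ht⟩) (not_le.2 ht'.1)
  have hlt : ∀ t, 0 ≤ t → t < T → D y + t • v ∈ starDomain D y := by
    intro t ht htT
    obtain ⟨r, hr, htr⟩ := exists_lt_of_lt_csSup ⟨0, hJ0⟩ htT
    exact star_segment hr.2 ⟨ht, htr.le⟩
  have hTpos : 0 < T := by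
    refine lt_of_le_of_ne hT0 fun h => hTJ ?_
    rw [← h]
    simpa using apply_mem_starDomain hD
  have hv0 : v ≠ 0 := by
    rintro rfl
    exact hTJ (by simpa using apply_mem_starDomain hD)
  -- The parameters start at `T / 2` so that a step `τ` with `t + τ < T` satisfies `τ < t`, which
  -- keeps `t - τ` on the ray.
  have hQb : BddAbove (F '' Ico (T / 2) T) := by
    refine ⟨c, ?_⟩
    rintro _ ⟨t, ht, rfl⟩
    have h0 : 0 ≤ t := by linarith [ht.1]
    exact hbound t ⟨h0, ht.2.le.trans hT1⟩ (hlt t h0 ht.2)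
  have hQn : (F '' Ico (T / 2) T).Nonempty := ⟨_, T / 2, ⟨le_rfl, by linarith⟩, rfl⟩
  -- A parameter where `F` is within `δ` of its supremum.
  obtain ⟨_, ⟨t, ht, rfl⟩, hFt⟩ := exists_lt_of_lt_csSup hQn (sub_lt_self _ hδ)
  have ht0 : 0 ≤ t := by linarith [ht.1]
  have hts := hlt t ht0 ht.2
  obtain ⟨A, W, s, hW, hA⟩ := hU (starExp D y (D y + t • v))
  rw [starExp_right_inv hD hts] at hA
  have hw0 : A.symm v ≠ 0 := by simpa using hv0
  obtain ⟨τ, hτ, hτn⟩ : ∃ τ : ℝ, 0 < τ ∧ ‖τ • A.symm v‖ = 1 :=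
    ⟨‖A.symm v‖⁻¹, by positivity, by simp [norm_smul, norm_ne_zero_iff.2 hw0]⟩
  obtain ⟨hp, hm, hgap⟩ := hA _ hτn
  simp only [map_smul, LinearEquiv.apply_symm_apply] at hp hm hgap
  have hp' : D y + t • v + τ • v = D y + (t + τ) • v := by rw [add_smul, add_assoc]
  have hm' : D y + t • v - τ • v = D y + (t - τ) • v := by rw [sub_smul, add_sub_assoc]
  rw [hp'] at hp hgap
  rw [hm'] at hm hgap
  have hmid : D y + t • v ∈ W := by simpa only [starExp_right_inv hD hts] using hW.mem
  -- Otherwise the convex set `W` contains the point of parameter `T`, and the ray extends past its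
  -- supposed end.
  have htτ : t + τ < T := by
    by_contra! hge
    refine hTJ (star_extend hD ht0 ht.2.le hts hW ?_)
    have := hW.convex.add_smul_sub_mem hmid hp (t := (T - t) / τ)
      ⟨div_nonneg (by linarith [ht.2]) hτ.le, div_le_one_of_le₀ (by linarith) hτ.le⟩
    rw [add_sub_add_left_eq_sub, ← sub_smul, smul_smul, add_sub_cancel_left,
      div_mul_cancel₀ _ hτ.ne', add_assoc, ← add_smul] at this
    simpa using this
  have hps := hlt _ (by linarith) htτ
  have e1 := starExp_eq_of_mem hD hps (t := t) ⟨ht0, by linarith⟩ (r := t + τ)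
    ⟨by linarith, le_rfl⟩ hW hp
  have e2 := starExp_eq_of_mem hD hps (t := t) ⟨ht0, by linarith⟩ (r := t - τ)
    ⟨by linarith [ht.1], by linarith⟩ hW hm
  rw [← e1, ← e2] at hgap
  -- Now `F (t + τ) ≥ 2 F t + 2δ - F (t - τ) ≥ F t + 2δ`, which exceeds the supremum.
  have hmono := apply_starExp_mono hD hc hf hcrit hts (t := t - τ) ⟨by linarith [ht.1], by linarith⟩
  have hle := le_csSup hQb ⟨t + τ, ⟨by linarith [ht.1], htτ⟩, rfl⟩
  simp only [hF] at hFt hle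
  linarith

theorem isClosed_sublevel_star (hD : IsLocalHomeomorph D) (hc : Continuous f)
    (hf : LocallyStrictConvex D f) (hu : UniformlyMidpointConvex D f)
    (hcrit : f =o[𝓝 y] fun z => D z - D y) (c : ℝ) :
    IsClosed {u ∈ starDomain D y | f (starExp D y u) ≤ c} := by
  refine isClosed_of_closure_subset fun u huc => ?_
  have hus := mem_star_of_mem_closure hD hc hf hu hcrit huc
  refine ⟨hus, ?_⟩
  by_contra! hlt
  have h1 : ∀ᶠ u in 𝓝 u, c < f (starExp D y u) :=
    ((hc.continuousAt.comp ((continuousOn_starExp hD).continuousAt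
      (isOpen_starDomain.mem_nhds hus))).eventually_const_lt hlt)
  obtain ⟨u, h2, h3⟩ := (mem_closure_iff_frequently.1 huc |>.and_eventually h1).exists
  exact absurd h2.2 (not_le.2 h3)

/-- The set of visible points is clopen and contains `y`. It is open because `D` is locally
injective, and closed because `f` is bounded near a limit point, so that the limit stays in the
star. -/
theorem starExp_left_inv [PreconnectedSpace Ω] (hD : IsLocalHomeomorph D) (hc : Continuous f)
    (hf : LocallyStrictConvex D f) (hu : UniformlyMidpointConvex D f)
    (hcrit : f =o[𝓝 y] fun z => D z - D y) (z : Ω) : D z ∈ starDomain D y ∧ starExp D y (D z) = z := by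
  set Z : Set Ω := {z | D z ∈ starDomain D y ∧ starExp D y (D z) = z} with hZ
  have hcont : ∀ z, D z ∈ starDomain D y → ContinuousAt (fun z => starExp D y (D z)) z :=
    fun z hz => ((continuousOn_starExp hD).continuousAt (isOpen_starDomain.mem_nhds hz)).comp
      hD.continuous.continuousAt
  have hopen : IsOpen Z := by
    rw [isOpen_iff_mem_nhds]
    rintro z ⟨hz, hz'⟩
    obtain ⟨U, hUo, hzU, hinj⟩ := hD.isLocallyInjective z
    have h1 := hcont z hz
    rw [ContinuousAt, hz'] at h1
    filter_upwards [h1.eventually (hUo.mem_nhds hzU), hUo.mem_nhds hzU,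
      hD.continuous.continuousAt.preimage_mem_nhds (isOpen_starDomain.mem_nhds hz)] with x hx1 hx2 hx3
    exact ⟨hx3, hinj hx1 hx2 (starExp_right_inv hD hx3)⟩
  have hclosed : IsClosed Z := by
    refine isClosed_of_closure_subset fun z hzc => ?_
    have hfr := mem_closure_iff_frequently.1 hzc
    have hlt : ∀ᶠ x in 𝓝 z, f x < f z + 1 :=
      hc.continuousAt.eventually_lt_const (lt_add_one (f z))
    have hz : D z ∈ starDomain D y := by
      refine mem_star_of_mem_closure hD hc hf hu hcrit (c := f z + 1) ?_
      rw [mem_closure_iff_frequently]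
      refine hD.continuous.continuousAt.frequently ?_
      refine (hfr.and_eventually hlt).mono fun x hx => ⟨hx.1.1, ?_⟩
      rw [hx.1.2]
      exact hx.2.le
    exact ⟨hz, tendsto_nhds_unique_of_frequently_eq (hcont z hz) tendsto_id
      (hfr.mono fun x hx => hx.2)⟩
  have huniv := IsClopen.eq_univ ⟨hclosed, hopen⟩ ⟨y, apply_mem_starDomain hD, starExp_apply_self hD⟩
  exact huniv.symm.subset (mem_univ z)

/-- A locally and uniformly strictly convex function with a critical point is positive away from this
point. -/
theorem pos_of_isLittleO [PreconnectedSpace Ω] (hD : IsLocalHomeomorph D) (hc : Continuous f)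
    (hf : LocallyStrictConvex D f) (hu : UniformlyMidpointConvex D f)
    (hcrit : f =o[𝓝 y] fun z => D z - D y) {z : Ω} (hz : z ≠ y) : 0 < f z := by
  obtain ⟨h1, h2⟩ := starExp_left_inv hD hc hf hu hcrit z
  have := apply_starExp_pos hD hc hf hcrit h1 fun h => hz <| by
    rw [← h2, h, starExp_apply_self hD]
  rwa [h2] at this

/-- A locally and uniformly strictly convex function with a critical point has compact sublevel
sets. -/
theorem isCompact_sublevel_of_isLittleO [FiniteDimensional ℝ E] [PreconnectedSpace Ω]
    (hD : IsLocalHomeomorph D) (hc : Continuous f)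
    (hf : LocallyStrictConvex D f) (hu : UniformlyMidpointConvex D f)
    (hcrit : f =o[𝓝 y] fun z => D z - D y) (c : ℝ) : IsCompact {z | f z ≤ c} := by
  have : ProperSpace E := FiniteDimensional.proper_real E
  have himage : {z | f z ≤ c} = starExp D y '' {u ∈ starDomain D y | f (starExp D y u) ≤ c} := by
    ext z
    obtain ⟨h1, h2⟩ := starExp_left_inv hD hc hf hu hcrit z
    constructor
    · exact fun hz => ⟨D z, ⟨h1, by rwa [h2]⟩, h2⟩
    · rintro ⟨u, hu, rfl⟩
      exact hu.2
  rw [himage]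
  refine IsCompact.image_of_continuousOn ?_ ((continuousOn_starExp hD).mono fun u hu => hu.1)
  refine Metric.isCompact_of_isClosed_isBounded (isClosed_sublevel_star hD hc hf hu hcrit c) ?_
  obtain ⟨ε, hε, hball⟩ := Metric.nhds_basis_closedBall.mem_iff.1
    (isOpen_starDomain.mem_nhds (apply_mem_starDomain (y := y) hD))
  have hFc : ContinuousOn (fun u => f (starExp D y u)) (starDomain D y) :=
    hc.comp_continuousOn (continuousOn_starExp hD)
  -- The sphere is empty in dimension zero, where any `m` serves.
  obtain ⟨m, hm, hmle⟩ : ∃ m > 0, ∀ u ∈ Metric.sphere (D y) ε, m ≤ f (starExp D y u) := by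
    rcases (Metric.sphere (D y) ε).eq_empty_or_nonempty with he | hne
    · exact ⟨1, one_pos, by simp [he]⟩
    · obtain ⟨u, hus, humin⟩ := (isCompact_sphere (D y) ε).exists_isMinOn hne
        (hFc.mono (Metric.sphere_subset_closedBall.trans hball))
      refine ⟨_, apply_starExp_pos hD hc hf hcrit
        (hball (Metric.sphere_subset_closedBall hus)) ?_, fun v hv => humin hv⟩
      rintro rfl
      simp [hε.ne] at hus
  -- Beyond the radius `ε`, the ray inequality gives `m < (ε / ‖u - D y‖) c`, hence the bound `ε c /
  -- m`.
  refine (Metric.isBounded_closedBall (x := D y) (r := max ε (ε * c / m))).subset ?_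
  rintro u ⟨hus, huc⟩
  rw [Metric.mem_closedBall, dist_eq_norm, le_max_iff]
  by_contra! hcon
  obtain ⟨h1, h2⟩ := hcon
  have hpos : 0 < ‖u - D y‖ := hε.trans h1
  have ht : ε / ‖u - D y‖ ∈ Ioo (0 : ℝ) 1 := ⟨div_pos hε hpos, (div_lt_one hpos).2 h1⟩
  have h3 := apply_starExp_smul_lt hD hc hf (apply_eq_zero_of_isLittleO hcrit) (v := u - D y)
    (by simpa using hus) (norm_pos_iff.1 hpos) ht
  have h4 := hmle (D y + (ε / ‖u - D y‖) • (u - D y)) (by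
    rw [mem_sphere_iff_norm, add_sub_cancel_left, norm_smul, Real.norm_eq_abs, abs_of_pos ht.1,
      div_mul_cancel₀ _ hpos.ne'])
  rw [add_sub_cancel] at h3
  have h5 : m < ε / ‖u - D y‖ * c := h4.trans_lt (h3.trans_le (mul_le_mul_of_nonneg_left huc ht.1.le))
  rw [div_lt_iff₀ hm] at h2
  rw [div_mul_eq_mul_div, lt_div_iff₀ hpos] at h5
  linarith

end Star

/-! ### Affine germs -/

/-- Affine maps are determined by their germ along a map that is locally onto. -/
theorem affineMap_eq_of_eventuallyEq {X E F : Type*} [TopologicalSpace X] [NormedAddCommGroup E]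
    [NormedSpace ℝ E] [AddCommGroup F] [Module ℝ F] {h : X → E} {y : X} (hh : map h (𝓝 y) = 𝓝 (h y))
    {a b : E →ᵃ[ℝ] F} (hab : ∀ᶠ z in 𝓝 y, a (h z) = b (h z)) : a = b := by
  have h1 : ∀ᶠ u in 𝓝 (h y), a u = b u := by
    rw [← hh]
    exact hab
  obtain ⟨U, hU, hUo, hyU⟩ := eventually_nhds_iff.1 h1
  exact AffineMap.ext_on (hUo.affineSpan_eq_top ⟨_, hyU⟩) hU

/-! ### Universal coverings, and the covering of germs of affine sections. -/

section Manifold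

variable {n : ℕ} {M : Type u} [TopologicalSpace M] [ChartedSpace (Coord n) M]

theorem exists_affine_chart_change [IsAffineManifold n M] {x x' z : M}
    (hx : z ∈ (chartAt (Coord n) x).source) (hx' : z ∈ (chartAt (Coord n) x').source) :
    ∃ A : Coord n ≃ᵃ[ℝ] Coord n, ∀ᶠ m in 𝓝 z, chartAt (Coord n) x' m = A (chartAt (Coord n) x m) :=
  IsAffineManifold.transition_affine _ (chart_mem_atlas _ _) _ (chart_mem_atlas _ _) z ⟨hx, hx'⟩

theorem map_nhds_chartAt {x z : M} (hz : z ∈ (chartAt (Coord n) x).source) :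
    map (chartAt (Coord n) x) (𝓝 z) = 𝓝 (chartAt (Coord n) x z) :=
  (chartAt (Coord n) x).map_nhds_eq hz

theorem UniversalCovering.map_nhds_π (P : UniversalCovering.{u, t} M) (y : P.Space) :
    map P.π (𝓝 y) = 𝓝 (P.π y) := P.isCoveringMap.isLocalHomeomorph.map_nhds_eq y

theorem UniversalCovering.map_nhds_chart (P : UniversalCovering.{u, t} M) (y : P.Space) :
    map (fun z => chartAt (Coord n) (P.π y) (P.π z)) (𝓝 y)
      = 𝓝 (chartAt (Coord n) (P.π y) (P.π y)) := by
  rw [← map_nhds_chartAt (mem_chart_source _ _), ← P.map_nhds_π, map_map]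
  rfl

/-- The total space of a local homeomorphism is locally path connected if the base is. -/
theorem _root_.IsLocalHomeomorph.locallyPathConnectedSpace {X Y : Type*} [TopologicalSpace X]
    [TopologicalSpace Y] [LocallyPathConnectedSpace Y] {f : X → Y} (hf : IsLocalHomeomorph f) :
    LocallyPathConnectedSpace X := by
  let cs : ChartedSpace Y X :=
    { atlas := range fun x => (hf x).choose
      chartAt := fun x => (hf x).choose
      mem_chart_source := fun x => (hf x).choose_spec.1
      chart_mem_atlas := fun x => mem_range_self x }
  exact ChartedSpace.locallyPathConnectedSpace Y X

theorem UniversalCovering.locallyPathConnectedSpace (n : ℕ) [ChartedSpace (Coord n) M]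
    (P : UniversalCovering.{u, t} M) : LocallyPathConnectedSpace P.Space := by
  have : LocallyPathConnectedSpace M := ChartedSpace.locallyPathConnectedSpace (Coord n) M
  exact P.isCoveringMap.isLocalHomeomorph.locallyPathConnectedSpace

theorem UniversalCovering.t2Space [T2Space M] (P : UniversalCovering.{u, t} M) :
    T2Space P.Space := by
  refine ⟨fun y z hyz => ?_⟩
  by_cases h : P.π y = P.π z
  · exact P.isCoveringMap.isSeparatedMap y z h hyz
  · obtain ⟨U, V, hU, hV, hyU, hzV, hUV⟩ := t2_separation h
    exact ⟨_, _, hU.preimage P.isCoveringMap.continuous, hV.preimage P.isCoveringMap.continuous, hyU,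
      hzV, hUV.preimage _⟩

/-- The deck transformations act transitively on the fibres of the universal covering. -/
theorem UniversalCovering.exists_deck (P : UniversalCovering.{u, t} M)
    [LocallyPathConnectedSpace P.Space] {y z : P.Space} (h : P.π y = P.π z) :
    ∃ γ : P.deck, γ.1 y = z := by
  let p : C(P.Space, M) := ⟨P.π, P.isCoveringMap.continuous⟩
  obtain ⟨f, ⟨hf, hf'⟩, -⟩ := P.isCoveringMap.existsUnique_continuousMap_lifts p y z h.symm
  obtain ⟨g, ⟨hg, hg'⟩, -⟩ := P.isCoveringMap.existsUnique_continuousMap_lifts p z y h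
  have hf1 : ∀ w, P.π (f w) = P.π w := fun w => congrFun hf' w
  have hg1 : ∀ w, P.π (g w) = P.π w := fun w => congrFun hg' w
  have hgf : (g ∘ f : P.Space → P.Space) = id :=
    P.isCoveringMap.eq_of_comp_eq (g.continuous.comp f.continuous) continuous_id
      (funext fun w => by simp [hf1, hg1]) y (by simp [hf, hg])
  have hfg : (f ∘ g : P.Space → P.Space) = id :=
    P.isCoveringMap.eq_of_comp_eq (f.continuous.comp g.continuous) continuous_id
      (funext fun w => by simp [hf1, hg1]) z (by simp [hf, hg])
  exact ⟨⟨⟨⟨f, g, congrFun hgf, congrFun hfg⟩, f.continuous, g.continuous⟩, hf1⟩, hf⟩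

/-- Affine functions on `ℝⁿ`, as a discrete space of germs. -/
def AffineGerm (n : ℕ) : Type := Coord n →ᵃ[ℝ] ℝ

instance : TopologicalSpace (AffineGerm n) := ⊥

instance : DiscreteTopology (AffineGerm n) := ⟨rfl⟩

namespace AffineRBundle

variable (L : AffineRBundle.{u, v, w} n M)

theorem transition_self {i : L.Index} {x : M} (hx : x ∈ L.base i) : L.transition i i x = 0 := by
  obtain ⟨y, rfl, -⟩ := (L.bijOn_coord i x hx).surjOn (mem_univ 0)
  linarith [L.coord_eq i i y hx hx]

theorem transition_add {i j k : L.Index} {x : M} (hi : x ∈ L.base i) (hj : x ∈ L.base j)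
    (hk : x ∈ L.base k) : L.transition i j x + L.transition j k x = L.transition i k x := by
  obtain ⟨y, rfl, -⟩ := (L.bijOn_coord i x hi).surjOn (mem_univ 0)
  linarith [L.coord_eq i j y hi hj, L.coord_eq j k y hj hk, L.coord_eq i k y hi hk]

/-- The set over which the chart and the trivialization at `x` are defined. -/
def germBase (x : M) : Set M := (chartAt (Coord n) x).source ∩ L.base (L.indexAt x)

theorem isOpen_germBase (x : M) : IsOpen (L.germBase x) :=
  (chartAt (Coord n) x).open_source.inter (L.isOpen_base _)

theorem mem_germBase (x : M) : x ∈ L.germBase x := ⟨mem_chart_source _ _, L.mem_base_indexAt x⟩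

/-- The affine functions `a` and `b`, in the charts and trivializations at `x` and `x'`, represent the
same germ of a section of `L` at `z`. -/
def SameGerm (x x' z : M) (a b : AffineGerm n) : Prop :=
  ∀ᶠ m in 𝓝 z, (show Coord n →ᵃ[ℝ] ℝ from b) (chartAt (Coord n) x' m)
    = (show Coord n →ᵃ[ℝ] ℝ from a) (chartAt (Coord n) x m)
      + L.transition (L.indexAt x') (L.indexAt x) m

variable {L}

theorem SameGerm.unique {x x' z : M} {a b b' : AffineGerm n} (hz : z ∈ L.germBase x')
    (h : L.SameGerm x x' z a b) (h' : L.SameGerm x x' z a b') : b = b' :=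
  affineMap_eq_of_eventuallyEq (map_nhds_chartAt hz.1) (by
    filter_upwards [h, h'] with m h1 h2 using h1.trans h2.symm)

theorem SameGerm.refl {x z : M} (hz : z ∈ L.germBase x) (a : AffineGerm n) :
    L.SameGerm x x z a a := by
  filter_upwards [(L.isOpen_germBase x).mem_nhds hz] with m hm
  rw [L.transition_self hm.2, add_zero]

theorem SameGerm.trans {x x' x'' z : M} {a b c : AffineGerm n} (hz : z ∈ L.germBase x)
    (hz' : z ∈ L.germBase x') (hz'' : z ∈ L.germBase x'')
    (h : L.SameGerm x x' z a b) (h' : L.SameGerm x' x'' z b c) : L.SameGerm x x'' z a c := by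
  filter_upwards [h, h', (L.isOpen_germBase x).mem_nhds hz, (L.isOpen_germBase x').mem_nhds hz',
    (L.isOpen_germBase x'').mem_nhds hz''] with m h1 h2 h3 h4 h5
  rw [h2, h1, ← L.transition_add h5.2 h4.2 h3.2]
  ring

theorem SameGerm.exists [IsAffineManifold n M] {x x' z : M} (hz : z ∈ L.germBase x)
    (hz' : z ∈ L.germBase x') (a : AffineGerm n) : ∃ b, L.SameGerm x x' z a b := by
  obtain ⟨A, hA⟩ := exists_affine_chart_change hz'.1 hz.1
  obtain ⟨B, hB⟩ := exists_affine_chart_change hz'.1 (mem_chart_source (Coord n) z)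
  obtain ⟨t, ht⟩ := L.transition_affine (L.indexAt x') (L.indexAt x) z ⟨hz'.2, hz.2⟩
  refine ⟨(show Coord n →ᵃ[ℝ] ℝ from a).comp A.toAffineMap + t.comp B.toAffineMap, ?_⟩
  filter_upwards [hA, hB, ht] with m h1 h2 h3
  simp only [id] at h3
  rw [h3, h2, h1]
  rfl

variable (L)

open Classical in
/-- The identification of germs at `z` in the charts and trivializations at `x` and `x'`. -/
def germChange (x x' z : M) (a : AffineGerm n) : AffineGerm n :=
  if h : ∃ b, L.SameGerm x x' z a b then h.choose else a

variable {L}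

theorem sameGerm_germChange [IsAffineManifold n M] {x x' z : M} (hz : z ∈ L.germBase x)
    (hz' : z ∈ L.germBase x') (a : AffineGerm n) :
    L.SameGerm x x' z a (L.germChange x x' z a) := by
  have h := SameGerm.exists hz hz' a
  rw [germChange, dif_pos h]
  exact h.choose_spec

theorem SameGerm.germChange_eq [IsAffineManifold n M] {x x' z : M} (hz : z ∈ L.germBase x)
    (hz' : z ∈ L.germBase x') {a b : AffineGerm n} (h : L.SameGerm x x' z a b) :
    L.germChange x x' z a = b :=
  (sameGerm_germChange hz hz' a).unique hz' h

variable (L)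

/-- The bundle of germs of affine sections of `L`. -/
def germBundle [IsAffineManifold n M] : FiberBundleCore M M (AffineGerm n) where
  baseSet := L.germBase
  isOpen_baseSet := L.isOpen_germBase
  indexAt := id
  mem_baseSet_at := L.mem_germBase
  coordChange := L.germChange
  coordChange_self _ _ hz a := (SameGerm.refl hz a).germChange_eq hz hz
  continuousOn_coordChange x x' := by
    rintro ⟨z, a⟩ ⟨⟨hz, hz'⟩, -⟩
    have h1 := sameGerm_germChange hz hz' a
    refine ContinuousAt.continuousWithinAt ?_
    refine (continuousAt_const (y := L.germChange x x' z a)).congr ?_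
    -- Having the same germ is an open condition on the point, and the fibre is discrete, so the
    -- change of coordinates is locally constant.
    have h2 : ∀ᶠ p : M × AffineGerm n in 𝓝 (z, a), p.2 = a :=
      continuous_snd.continuousAt.eventually ((isOpen_discrete {a}).mem_nhds (mem_singleton a))
    have h3 : ∀ᶠ p : M × AffineGerm n in 𝓝 (z, a),
        L.SameGerm x x' p.1 a (L.germChange x x' z a) :=
      continuous_fst.continuousAt.eventually (eventually_eventually_nhds.2 h1)
    have h4 : ∀ᶠ p : M × AffineGerm n in 𝓝 (z, a), p.1 ∈ L.germBase x ∩ L.germBase x' :=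
      continuous_fst.continuousAt.eventually
        (((L.isOpen_germBase x).inter (L.isOpen_germBase x')).mem_nhds ⟨hz, hz'⟩)
    filter_upwards [h2, h3, h4] with p hp2 hp3 hp4
    rw [hp2]
    exact (hp3.germChange_eq hp4.1 hp4.2).symm
  coordChange_comp x x' x'' z := by
    rintro ⟨⟨hz, hz'⟩, hz''⟩ a
    exact (((sameGerm_germChange hz hz' a).trans hz hz' hz''
      (sameGerm_germChange hz' hz'' _)).germChange_eq hz hz'').symm

/-- Affine sections extend from germs to the whole universal covering. -/
theorem exists_affSec [IsAffineManifold n M] (P : UniversalCovering.{u, t} M) (y₀ : P.Space)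
    (a : Coord n →ᵃ[ℝ] ℝ) : ∃ q : L.AffSec P, ∀ᶠ z in 𝓝 y₀,
      L.coord (L.indexAt (P.π y₀)) (q.toFun z) = a (chartAt (Coord n) (P.π y₀) (P.π z)) := by
  have := P.locallyPathConnectedSpace n
  let Z := L.germBundle
  -- Discrete fibres make the bundle of germs a covering of `M`, to which `π` lifts because `Ω` is
  -- simply connected.
  have hcov : IsCoveringMap (Bundle.TotalSpace.proj : Z.TotalSpace → M) :=
    FiberBundle.isCoveringMap (F := AffineGerm n) (E := Z.Fiber)
  obtain ⟨f, ⟨hf, hf'⟩, -⟩ := hcov.existsUnique_continuousMap_lifts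
    ⟨P.π, P.isCoveringMap.continuous⟩ y₀ ⟨P.π y₀, a⟩ rfl
  have hex : ∀ z, ∃ g : AffineGerm n, f z = ⟨P.π z, g⟩ := by
    intro z
    have h1 : (f z).proj = P.π z := congrFun hf' z
    rcases h2 : f z with ⟨x, g⟩
    rw [h2] at h1
    subst h1
    exact ⟨g, rfl⟩
  choose g hg using hex
  have hg0 : g y₀ = a := by
    injection (hg y₀).symm.trans hf
  -- Continuity of the lift into the discrete fibre: near `y`, all the germs `g z` are germs of the
  -- one affine function `g y`.
  have hloc : ∀ y, ∀ᶠ z in 𝓝 y, L.SameGerm (P.π z) (P.π y) (P.π z) (g z) (g y) := by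
    intro y
    have hsrc : f y ∈ (Z.localTriv (P.π y)).source := by
      rw [Z.mem_localTriv_source, hg]
      exact L.mem_germBase _
    have h1 : ContinuousAt (fun z => (Z.localTriv (P.π y) (f z)).2) y :=
      continuous_snd.continuousAt.comp
        (((Z.localTriv (P.π y)).continuousAt hsrc).comp f.continuous.continuousAt)
    have h2 : ∀ z, (Z.localTriv (P.π y) (f z)).2 = L.germChange (P.π z) (P.π y) (P.π z) (g z) := by
      intro z
      rw [hg]
      rfl
    simp only [h2] at h1
    have h3 : L.germChange (P.π y) (P.π y) (P.π y) (g y) = g y :=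
      (SameGerm.refl (L.mem_germBase _) _).germChange_eq (L.mem_germBase _) (L.mem_germBase _)
    have h4 := h1.eventually ((isOpen_discrete {g y}).mem_nhds h3)
    filter_upwards [h4, P.isCoveringMap.continuous.continuousAt.preimage_mem_nhds
      ((L.isOpen_germBase (P.π y)).mem_nhds (L.mem_germBase _))] with z hz hz'
    have h5 := sameGerm_germChange (L.mem_germBase (P.π z)) hz' (g z)
    rwa [show L.germChange (P.π z) (P.π y) (P.π z) (g z) = g y from hz] at h5
  have hpt : ∀ z, ∃ l, L.proj l = P.π z ∧ L.coord (L.indexAt (P.π z)) l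
      = (show Coord n →ᵃ[ℝ] ℝ from g z) (chartAt (Coord n) (P.π z) (P.π z)) := fun z =>
    (L.bijOn_coord _ _ (L.mem_base_indexAt (P.π z))).surjOn (mem_univ _)
  choose q hq hq' using hpt
  have hcoord : ∀ y, ∀ᶠ z in 𝓝 y, L.coord (L.indexAt (P.π y)) (q z)
      = (show Coord n →ᵃ[ℝ] ℝ from g y) (chartAt (Coord n) (P.π y) (P.π z)) := by
    intro y
    filter_upwards [hloc y, P.isCoveringMap.continuous.continuousAt.preimage_mem_nhds
      ((L.isOpen_germBase (P.π y)).mem_nhds (L.mem_germBase _))] with z hz hz'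
    rw [hz.self_of_nhds, ← hq', L.coord_eq _ (L.indexAt (P.π z)) (q z) (by rw [hq]; exact hz'.2)
      (by rw [hq]; exact L.mem_base_indexAt _), hq]
  refine ⟨⟨q, hq, fun i y hy => ?_⟩, by simpa only [hg0] using hcoord y₀⟩
  obtain ⟨t, ht⟩ := L.transition_affine i (L.indexAt (P.π y)) (P.π y) ⟨hy, L.mem_base_indexAt _⟩
  refine ⟨(show Coord n →ᵃ[ℝ] ℝ from g y) + t, ?_⟩
  have hbase : ∀ᶠ m in 𝓝 (P.π y), m ∈ L.base i ∩ L.base (L.indexAt (P.π y)) :=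
    ((L.isOpen_base i).inter (L.isOpen_base _)).mem_nhds ⟨hy, L.mem_base_indexAt _⟩
  filter_upwards [hcoord y, P.isCoveringMap.continuous.continuousAt.eventually ht,
    P.isCoveringMap.continuous.continuousAt.eventually hbase] with z h1 h2 h3
  simp only [id] at h2
  rw [L.coord_eq i (L.indexAt (P.π y)) (q z) (by rw [hq]; exact h3.1) (by rw [hq]; exact h3.2), h1,
    hq, h2]
  rfl

end AffineRBundle

end Manifold

/-! ### Locally affine maps and developing maps on the universal covering. -/

section Developing

variable {n : ℕ} {M : Type u} [TopologicalSpace M] [ChartedSpace (Coord n) M]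
  {P : UniversalCovering.{u, t} M} {F : Type*} [AddCommGroup F] [Module ℝ F]

/-- Maps on the universal covering which are affine in the affine coordinates. -/
def UniversalCovering.IsLocallyAffine (P : UniversalCovering.{u, t} M) (f : P.Space → F) : Prop :=
  ∀ y, ∃ a : Coord n →ᵃ[ℝ] F, ∀ᶠ z in 𝓝 y, f z = a (chartAt (Coord n) (P.π y) (P.π z))

variable (n) in
/-- Developing maps: maps to `ℝⁿ` which are affine coordinates near each point. -/
def UniversalCovering.IsDeveloping (P : UniversalCovering.{u, t} M) (D : P.Space → Coord n) : Prop :=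
  ∀ y, ∃ A : Coord n ≃ᵃ[ℝ] Coord n, ∀ᶠ z in 𝓝 y, D z = A (chartAt (Coord n) (P.π y) (P.π z))

namespace UniversalCovering

theorem IsLocallyAffine.sub {f g : P.Space → F} (hf : P.IsLocallyAffine (n := n) f)
    (hg : P.IsLocallyAffine (n := n) g) : P.IsLocallyAffine (n := n) (fun z => f z - g z) := by
  intro y
  obtain ⟨a, ha⟩ := hf y
  obtain ⟨b, hb⟩ := hg y
  refine ⟨a - b, ?_⟩
  filter_upwards [ha, hb] with z h1 h2
  rw [h1, h2]
  rfl

theorem IsLocallyAffine.affineMap_comp {F' : Type*} [AddCommGroup F'] [Module ℝ F']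
    {f : P.Space → F} (hf : P.IsLocallyAffine (n := n) f) (a : F →ᵃ[ℝ] F') :
    P.IsLocallyAffine (n := n) (fun z => a (f z)) := by
  intro y
  obtain ⟨b, hb⟩ := hf y
  refine ⟨a.comp b, ?_⟩
  filter_upwards [hb] with z h1
  rw [h1]
  rfl

theorem IsLocallyAffine.comp_deck {f : P.Space → F} (hf : P.IsLocallyAffine (n := n) f)
    (γ : P.deck) : P.IsLocallyAffine (n := n) (fun z => f (γ.1 z)) := by
  intro y
  obtain ⟨b, hb⟩ := hf (γ.1 y)
  refine ⟨b, ?_⟩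
  filter_upwards [(γ.1.continuous.tendsto y).eventually hb] with z h1
  rw [h1, γ.2, γ.2]

/-- Identity principle: the set of points where the germ vanishes is clopen, because an affine
function vanishing on a nonempty open set is zero. -/
theorem IsLocallyAffine.eq_zero {f : P.Space → F} (hf : P.IsLocallyAffine (n := n) f)
    {y₀ : P.Space} (h₀ : ∀ᶠ z in 𝓝 y₀, f z = 0) (z : P.Space) : f z = 0 := by
  have hopen : IsOpen {y | ∀ᶠ z in 𝓝 y, f z = 0} :=
    isOpen_iff_mem_nhds.2 fun y hy => eventually_eventually_nhds.2 hy
  have hclosed : IsClosed {y | ∀ᶠ z in 𝓝 y, f z = 0} := by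
    refine isClosed_of_closure_subset fun y hy => ?_
    obtain ⟨a, ha⟩ := hf y
    obtain ⟨U, hU, hUo, hyU⟩ := eventually_nhds_iff.1
      (ha.and (P.isCoveringMap.continuous.continuousAt.preimage_mem_nhds
        ((chartAt (Coord n) (P.π y)).open_source.mem_nhds (mem_chart_source _ _))))
    obtain ⟨x, hxU, hx⟩ := mem_closure_iff.1 hy U hUo hyU
    have hmap : map (fun z => chartAt (Coord n) (P.π y) (P.π z)) (𝓝 x)
        = 𝓝 (chartAt (Coord n) (P.π y) (P.π x)) := by
      rw [← map_nhds_chartAt (hU x hxU).2, ← P.map_nhds_π, map_map]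
      rfl
    have ha0 : a = 0 := by
      refine affineMap_eq_of_eventuallyEq hmap ?_
      filter_upwards [hx, hUo.mem_nhds hxU] with z h1 h2
      rw [← (hU z h2).1, h1]
      rfl
    filter_upwards [ha] with z hz
    rw [hz, ha0]
    rfl
  have huniv := IsClopen.eq_univ ⟨hclosed, hopen⟩ ⟨y₀, h₀⟩
  exact (huniv.symm.subset (mem_univ z)).self_of_nhds

theorem IsDeveloping.isLocallyAffine {D : P.Space → Coord n} (hD : P.IsDeveloping n D) :
    P.IsLocallyAffine (n := n) D := fun y =>
  let ⟨A, hA⟩ := hD y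
  ⟨A.toAffineMap, hA⟩

theorem IsDeveloping.isLocalHomeomorph {D : P.Space → Coord n} (hD : P.IsDeveloping n D) :
    IsLocalHomeomorph D := by
  refine IsLocalHomeomorph.mk _ fun y => ?_
  obtain ⟨A, hA⟩ := hD y
  obtain ⟨e, hye, he⟩ := P.isCoveringMap.isLocalHomeomorph y
  obtain ⟨U, hU, hUo, hyU⟩ := eventually_nhds_iff.1 hA
  refine ⟨((e.trans (chartAt (Coord n) (P.π y))).trans
    A.toContinuousAffineEquiv.toHomeomorph.toOpenPartialHomeomorph).restrOpen U hUo, ?_, ?_⟩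
  · have : e y ∈ (chartAt (Coord n) (P.π y)).source := by rw [← he]; exact mem_chart_source _ _
    simp [hye, hyU, this]
  · rintro z hz
    have hzU : z ∈ U := by simpa using hz.2
    rw [hU z hzU, he]
    rfl

/-- By the identity principle it suffices to match the germs at one point, where `D` is an affine
coordinate system. -/
theorem IsDeveloping.exists_eq_comp {D : P.Space → Coord n} (hD : P.IsDeveloping n D)
    {f : P.Space → F} (hf : P.IsLocallyAffine (n := n) f) :
    ∃ a : Coord n →ᵃ[ℝ] F, ∀ z, f z = a (D z) := by
  let y₀ : P.Space := Classical.arbitrary _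
  obtain ⟨b, hb⟩ := hf y₀
  obtain ⟨A, hA⟩ := hD y₀
  refine ⟨b.comp A.symm.toAffineMap, fun z => ?_⟩
  rw [← sub_eq_zero]
  refine (hf.sub (hD.isLocallyAffine.affineMap_comp (b.comp A.symm.toAffineMap))).eq_zero
    (y₀ := y₀) ?_ z
  filter_upwards [hb, hA] with z h1 h2
  rw [h1, h2]
  simp

/-- The holonomy representation. The maps obtained from `γ` and `γ⁻¹` are inverse to each other,
because affine maps that agree on the image of a local homeomorphism are equal. -/
theorem IsDeveloping.exists_deck_linear {D : P.Space → Coord n} (hD : P.IsDeveloping n D)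
    (γ : P.deck) : ∃ B : Coord n ≃ᵃ[ℝ] Coord n, ∀ z, D (γ.1 z) = B (D z) := by
  have key : ∀ γ : P.deck, ∃ B : Coord n →ᵃ[ℝ] Coord n, ∀ z, D (γ.1 z) = B (D z) := fun γ =>
    hD.exists_eq_comp (hD.isLocallyAffine.comp_deck γ)
  have hinv : ∀ (B B' : Coord n →ᵃ[ℝ] Coord n) (γ γ' : P.deck), (∀ z, D (γ.1 z) = B (D z)) →
      (∀ z, D (γ'.1 z) = B' (D z)) → γ' * γ = 1 → B'.comp B = AffineMap.id ℝ _ := by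
    intro B B' γ γ' h h' hγ
    refine affineMap_eq_of_eventuallyEq
      (hD.isLocalHomeomorph.map_nhds_eq (Classical.arbitrary P.Space)) (Eventually.of_forall ?_)
    intro z
    have h1 : γ'.1 (γ.1 z) = z := congrArg (fun g : P.deck => g.1 z) hγ
    change B' (B (D z)) = D z
    rw [← h, ← h', h1]
  obtain ⟨B, hB⟩ := key γ
  obtain ⟨B', hB'⟩ := key γ⁻¹
  have h1 := hinv B B' γ γ⁻¹ hB hB' (inv_mul_cancel γ)
  have h2 := hinv B' B γ⁻¹ γ hB' hB (mul_inv_cancel γ)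
  refine ⟨⟨⟨B, B', fun x => congrArg (fun a : Coord n →ᵃ[ℝ] Coord n => a x) h1,
    fun x => congrArg (fun a : Coord n →ᵃ[ℝ] Coord n => a x) h2⟩,
    LinearEquiv.ofLinearMap B.linear B'.linear ?_ ?_, fun p v => B.map_vadd p v⟩, hB⟩
  · rw [← AffineMap.comp_linear, h2]; rfl
  · rw [← AffineMap.comp_linear, h1]; rfl

end UniversalCovering

namespace AffineRBundle

variable {L : AffineRBundle.{u, v, w} n M}

theorem diff_add_diff {a b c : L.Total} (hab : L.proj a = L.proj b) (hbc : L.proj b = L.proj c) :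
    L.diff a b + L.diff b c = L.diff a c := by
  have hi := L.mem_base_indexAt (L.proj a)
  rw [L.diff_eq hab hi, L.diff_eq hbc (i := L.indexAt (L.proj a)) (by rw [← hab]; exact hi),
    L.diff_eq (hab.trans hbc) hi]
  ring

theorem isLocallyAffine_diff (q q' : L.AffSec P) :
    P.IsLocallyAffine (n := n) (fun z => L.diff (q.toFun z) (q'.toFun z)) := by
  intro y
  have hi := L.mem_base_indexAt (P.π y)
  obtain ⟨a, ha⟩ := q.affine _ y hi
  obtain ⟨b, hb⟩ := q'.affine _ y hi
  refine ⟨a - b, ?_⟩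
  filter_upwards [ha, hb, P.isCoveringMap.continuous.continuousAt.preimage_mem_nhds
    ((L.isOpen_base _).mem_nhds hi)] with z h1 h2 h3
  rw [L.diff_eq (by rw [q.proj_toFun, q'.proj_toFun]) (by rw [q.proj_toFun]; exact h3), h1, h2]
  rfl

/-- Differences of affine sections of `K` are affine functions, so the coordinates of `D` are
obtained by extending the coordinate germs at one point as sections and subtracting the extension of
the zero germ. -/
theorem exists_isDeveloping [IsAffineManifold n M] (L : AffineRBundle.{u, v, w} n M)
    (P : UniversalCovering.{u, t} M) : ∃ D, P.IsDeveloping n D := by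
  let y₀ : P.Space := Classical.arbitrary _
  obtain ⟨q₀, hq₀⟩ := L.exists_affSec P y₀ 0
  have hex := fun k : Fin n => L.exists_affSec P y₀
    ((LinearMap.proj k : (Fin n → ℝ) →ₗ[ℝ] ℝ).comp
      (WithLp.linearEquiv 2 ℝ (Fin n → ℝ)).toLinearMap).toAffineMap
  choose q hq using hex
  set D : P.Space → Coord n :=
    fun z => WithLp.toLp 2 fun k => L.diff ((q k).toFun z) (q₀.toFun z) with hDdef
  have hDaff : P.IsLocallyAffine (n := n) D := by
    intro y
    choose a ha using fun k => isLocallyAffine_diff (q k) q₀ y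
    refine ⟨(WithLp.linearEquiv 2 ℝ (Fin n → ℝ)).symm.toLinearMap.toAffineMap.comp
      (AffineMap.pi a), ?_⟩
    filter_upwards [eventually_all.2 ha] with z hz
    ext k
    exact hz k
  have hD₀ : ∀ᶠ z in 𝓝 y₀, D z = chartAt (Coord n) (P.π y₀) (P.π z) := by
    filter_upwards [hq₀, eventually_all.2 hq, P.isCoveringMap.continuous.continuousAt.preimage_mem_nhds
      ((L.isOpen_base _).mem_nhds (L.mem_base_indexAt (P.π y₀)))] with z h1 h2 h3
    ext k
    change L.diff _ _ = _
    rw [L.diff_eq (by rw [(q k).proj_toFun, q₀.proj_toFun])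
      (by rw [(q k).proj_toFun]; exact h3), h1, h2]
    exact sub_zero _
  refine ⟨D, fun y => ?_⟩
  obtain ⟨A, hA⟩ := hDaff y
  -- If the linear part degenerated at `y`, some nonzero linear form of `D` would be constant near
  -- `y`, hence everywhere, in particular near `y₀`, where `D` is a chart.
  have hsurj : LinearMap.range A.linear = ⊤ := by
    by_contra hne
    obtain ⟨l, hl0, hl⟩ := Submodule.exists_le_ker_of_lt_top _ (lt_top_iff_ne_top.2 hne)
    have hconst : ∀ u u', l (A u) = l (A u') := by
      intro u u'
      have h1 : l (A.linear (u - u')) = 0 := hl (LinearMap.mem_range_self _ _)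
      rw [← vsub_eq_sub, A.linearMap_vsub, vsub_eq_sub, map_sub, sub_eq_zero] at h1
      exact h1
    have hzero := (hDaff.affineMap_comp
      (l.toAffineMap - AffineMap.const ℝ (Coord n) (l (D y)))).eq_zero (y₀ := y) (by
        filter_upwards [hA] with z hz
        change l (D z) - l (D y) = 0
        rw [hz, hA.self_of_nhds, sub_eq_zero]
        exact hconst _ _)
    have heq : l.toAffineMap = AffineMap.const ℝ (Coord n) (l (D y)) := by
      refine affineMap_eq_of_eventuallyEq (P.map_nhds_chart y₀) ?_
      filter_upwards [hD₀] with z hz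
      rw [← hz]
      exact sub_eq_zero.1 (hzero z)
    exact hl0 (congrArg AffineMap.linear heq)
  have hlin : Function.Bijective A.linear :=
    ⟨LinearMap.injective_iff_surjective.2 (LinearMap.range_eq_top.1 hsurj),
      LinearMap.range_eq_top.1 hsurj⟩
  exact ⟨AffineEquiv.ofBijective (φ := A) (A.linear_bijective_iff.1 hlin), hA⟩

/-- The section `q + a ∘ D`. -/
def AffSec.addComp (q : L.AffSec P) {D : P.Space → Coord n} (hD : P.IsDeveloping n D)
    (a : Coord n →ᵃ[ℝ] ℝ) : L.AffSec P where
  toFun z := a (D z) +ᵥ q.toFun z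
  proj_toFun z := by rw [L.proj_vadd, q.proj_toFun]
  affine i y hy := by
    obtain ⟨b, hb⟩ := q.affine i y hy
    obtain ⟨A, hA⟩ := hD y
    refine ⟨a.comp A.toAffineMap + b, ?_⟩
    filter_upwards [hb, hA, P.isCoveringMap.continuous.continuousAt.preimage_mem_nhds
      ((L.isOpen_base i).mem_nhds hy)] with z h1 h2 h3
    rw [L.coord_vadd _ _ (by rw [q.proj_toFun]; exact h3), h1, h2]
    rfl

theorem Sec.Phi_addComp (φ : L.Sec) (q : L.AffSec P) {D : P.Space → Coord n}
    (hD : P.IsDeveloping n D) (a : Coord n →ᵃ[ℝ] ℝ) (z : P.Space) :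
    φ.Phi (q.addComp hD a) z = φ.Phi q z - a (D z) :=
  L.diff_vadd_right (by rw [φ.proj_toFun, q.proj_toFun]) _

end AffineRBundle

end Developing

/-! ### Differentials and uniform midpoint gaps in developing coordinates. -/

section Slope

variable {Ω : Type*} [TopologicalSpace Ω] {E : Type*} [NormedAddCommGroup E] [NormedSpace ℝ E]
  {D : Ω → E} {f : Ω → ℝ}

/-- Near each point, `f` is a `C¹` function of `D`. -/
def LocallyContDiff (D : Ω → E) (f : Ω → ℝ) : Prop :=
  ∀ y, ∃ G : E → ℝ, ContDiffAt ℝ 1 G (D y) ∧ ∀ᶠ z in 𝓝 y, f z = G (D z)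

/-- The representative `G` depends on the point, but two representatives have the same germ wherever
both are valid, since `D` is open. Hence their differentials fit together continuously. -/
theorem LocallyContDiff.exists_slope (hD : IsLocalHomeomorph D) (hf : LocallyContDiff D f) :
    ∃ l : Ω → E →L[ℝ] ℝ, Continuous l ∧
      ∀ y, (fun z => f z - (f y + l y (D z - D y))) =o[𝓝 y] fun z => D z - D y := by
  choose G hG hfG using hf
  refine ⟨fun y => fderiv ℝ (G y) (D y), ?_, fun y => ?_⟩
  · rw [continuous_iff_continuousAt]
    intro y
    have h1 : ContinuousAt (fun z => fderiv ℝ (G y) (D z)) y :=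
      ((hG y).fderiv_right (m := 0) le_rfl).continuousAt.comp hD.continuous.continuousAt
    refine h1.congr ?_
    filter_upwards [eventually_eventually_nhds.2 (hfG y)] with z hz
    refine Filter.EventuallyEq.fderiv_eq ?_
    change ∀ᶠ u in 𝓝 (D z), G y u = G z u
    rw [← hD.map_nhds_eq, eventually_map]
    filter_upwards [hz, hfG z] with x h2 h3 using h2.symm.trans h3
  · have h1 := ((hG y).differentiableAt one_ne_zero).hasFDerivAt.isLittleO
    refine (h1.comp_tendsto hD.continuous.continuousAt).congr' ?_ EventuallyEq.rfl
    filter_upwards [hfG y] with z hz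
    simp only [Function.comp, hz, (hfG y).self_of_nhds]
    ring

theorem LocallyContDiff.isLittleO_of_isLocalMin (hD : IsLocalHomeomorph D)
    (hf : LocallyContDiff D f) {y : Ω} (hy : IsLocalMin f y) :
    (fun z => f z - f y) =o[𝓝 y] fun z => D z - D y := by
  obtain ⟨G, hG, hfG⟩ := hf y
  have hmin : IsLocalMin G (D y) := by
    change ∀ᶠ u in 𝓝 (D y), G (D y) ≤ G u
    rw [← hD.map_nhds_eq, eventually_map]
    filter_upwards [hfG, hy] with z h1 h2
    rwa [← h1, ← hfG.self_of_nhds]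
  have h1 := (hG.differentiableAt one_ne_zero).hasFDerivAt.isLittleO
  rw [hmin.fderiv_eq_zero] at h1
  refine (h1.comp_tendsto hD.continuous.continuousAt).congr' ?_ EventuallyEq.rfl
  filter_upwards [hfG] with z hz
  simp [Function.comp, hz, hfG.self_of_nhds]

theorem IsConvexSection.eventually_left_inv (hD : IsLocalHomeomorph D) {y : Ω} {C : Set E}
    {s : E → Ω} (h : IsConvexSection D y C s) : ∀ᶠ z in 𝓝 y, s (D z) = z := by
  obtain ⟨U, hUo, hyU, hinj⟩ := hD.isLocallyInjective y
  have h1 : ContinuousAt (fun z => s (D z)) y :=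
    (h.continuousOn.continuousAt (h.isOpen.mem_nhds h.mem)).comp hD.continuous.continuousAt
  rw [ContinuousAt, h.apply_self] at h1
  filter_upwards [h1.eventually (hUo.mem_nhds hyU), hUo.mem_nhds hyU,
    hD.continuous.continuousAt.preimage_mem_nhds (h.isOpen.mem_nhds h.mem)] with z h2 h3 h4
  exact hinj h2 h3 (h.right_inv _ h4)

/-- The second difference with step `r` is continuous and positive on the compact set of pairs
(centre near `D y`, unit vector), so it has a positive lower bound `2δ` there. -/
theorem LocallyStrictConvex.eventually_midpointGap [FiniteDimensional ℝ E]
    (hD : IsLocalHomeomorph D) (hc : Continuous f) (hf : LocallyStrictConvex D f) (y : Ω) :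
    ∃ δ > 0, ∀ᶠ z in 𝓝 y, MidpointGap D f δ z := by
  have : ProperSpace E := FiniteDimensional.proper_real E
  obtain ⟨G, ⟨ε, hε, hG⟩, hfG⟩ := hf y
  obtain ⟨C, s, h⟩ := hD.exists_isConvexSection y
  have h1 : ∀ᶠ u in 𝓝 (D y), u ∈ C ∧ u ∈ Metric.ball (D y) ε ∧ f (s u) = G u := by
    have hs := h.continuousOn.continuousAt (h.isOpen.mem_nhds h.mem)
    rw [ContinuousAt, h.apply_self] at hs
    filter_upwards [h.isOpen.mem_nhds h.mem, Metric.ball_mem_nhds _ hε, hs.eventually hfG]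
      with u h2 h3 h4
    exact ⟨h2, h3, by rw [h4, h.right_inv u h2]⟩
  obtain ⟨R, hR, hball⟩ := Metric.nhds_basis_ball.mem_iff.1 h1
  -- A centre within `r` of `D y`, moved by a step of length `r`, stays within `2r < R`.
  obtain ⟨r, hr, hrR⟩ : ∃ r > 0, R = 3 * r := ⟨R / 3, by positivity, by ring⟩
  set K : Set (E × E) := Metric.closedBall (D y) r ×ˢ Metric.sphere 0 1 with hK
  have hKc : IsCompact K := (isCompact_closedBall _ _).prod (isCompact_sphere _ _)
  have hmem : ∀ p ∈ K, p.1 ∈ Metric.ball (D y) R ∧ p.1 + r • p.2 ∈ Metric.ball (D y) R ∧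
      p.1 - r • p.2 ∈ Metric.ball (D y) R := by
    rintro ⟨a, w⟩ ⟨ha, hw⟩
    have hw' : ‖r • w‖ = r := by
      rw [norm_smul, mem_sphere_zero_iff_norm.1 hw, mul_one, Real.norm_eq_abs, abs_of_pos hr]
    simp only [mem_closedBall_iff_norm] at ha
    simp only [mem_ball_iff_norm]
    refine ⟨by linarith, ?_, ?_⟩
    · rw [add_sub_right_comm]
      linarith [norm_add_le (a - D y) (r • w)]
    · rw [sub_right_comm]
      linarith [norm_sub_le (a - D y) (r • w)]
  have hfs : ContinuousOn (fun u => f (s u)) (Metric.ball (D y) R) :=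
    hc.comp_continuousOn (h.continuousOn.mono fun u hu => (hball hu).1)
  set H : E × E → ℝ := fun p => f (s (p.1 + r • p.2)) + f (s (p.1 - r • p.2)) - 2 * f (s p.1)
  have hHc : ContinuousOn H K := by
    refine ((hfs.comp (by fun_prop) fun p hp => (hmem p hp).2.1).add
      (hfs.comp (by fun_prop) fun p hp => (hmem p hp).2.2)).sub
      (continuousOn_const.mul (hfs.comp (by fun_prop) fun p hp => (hmem p hp).1))
  have hHpos : ∀ p ∈ K, 0 < H p := by
    intro p hp
    obtain ⟨h2, h3, h4⟩ := hmem p hp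
    have hw : p.2 ≠ 0 := by
      have := mem_sphere_zero_iff_norm.1 hp.2
      rw [← norm_ne_zero_iff, this]
      exact one_ne_zero
    have := hG.two_mul_lt (hball h4).2.1 (hball h3).2.1 (smul_ne_zero hr.ne' hw)
    simp only [H]
    rw [(hball h2).2.2, (hball h3).2.2, (hball h4).2.2]
    linarith
  obtain ⟨δ, hδ, hδH⟩ : ∃ δ > 0, ∀ p ∈ K, 2 * δ ≤ H p := by
    rcases K.eq_empty_or_nonempty with he | hne
    · exact ⟨1, one_pos, by simp [he]⟩
    · obtain ⟨p, hp, hmin⟩ := hKc.exists_isMinOn hne hHc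
      exact ⟨H p / 2, half_pos (hHpos p hp), fun p' hp' => by linarith [isMinOn_iff.1 hmin p' hp']⟩
  refine ⟨δ, hδ, ?_⟩
  filter_upwards [h.eventually_left_inv hD,
    hD.continuous.continuousAt.preimage_mem_nhds (Metric.closedBall_mem_nhds (D y) hr)] with z h2 h3
  refine ⟨LinearEquiv.smulOfNeZero ℝ E r hr.ne', Metric.ball (D y) R, s,
    ⟨Metric.isOpen_ball, convex_ball _ _, ?_, h.continuousOn.mono fun u hu => (hball hu).1, h2,
      fun u hu => h.right_inv u (hball hu).1⟩, fun w hw => ?_⟩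
  · exact Metric.closedBall_subset_ball (by linarith) h3
  · have hp : (D z, w) ∈ K := ⟨h3, mem_sphere_zero_iff_norm.2 hw⟩
    obtain ⟨-, h4, h5⟩ := hmem _ hp
    refine ⟨h4, h5, ?_⟩
    have := hδH _ hp
    simp only [H, h2] at this
    change 2 * f z + 2 * δ ≤ f (s (D z + r • w)) + f (s (D z - r • w))
    linarith

/-- Sublevel compactness gives properness. -/
theorem isProperMap_of_isCompact_sublevel {X : Type*} [TopologicalSpace X] {h : X → ℝ}
    (hc : Continuous h) (hs : ∀ c, IsCompact {x | h x ≤ c}) : IsProperMap h := by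
  refine isProperMap_iff_isCompact_preimage.2 ⟨hc, fun K hK => ?_⟩
  obtain ⟨c, hcK⟩ := hK.bddAbove
  exact (hs c).of_isClosed_subset (hK.isClosed.preimage hc) fun x hx => hcK hx

end Slope

namespace AffineRBundle

variable {n : ℕ} {M : Type u} [TopologicalSpace M] [ChartedSpace (Coord n) M]
  {L : AffineRBundle.{u, v, w} n M} {P : UniversalCovering.{u, t} M}

/-! ### Continuous sections -/

/-- Continuous sections. -/
def Sec.IsCont (φ : L.Sec) : Prop :=
  ∀ i, ∀ x ∈ L.base i, ContinuousAt (fun m => L.coord i (φ.toFun m)) x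

theorem Sec.eventually_localRep (φ : L.Sec) (i : L.Index) (x : M) :
    ∀ᶠ m in 𝓝 x, φ.localRep i x (chartAt (Coord n) x m) = L.coord i (φ.toFun m) := by
  filter_upwards [(chartAt (Coord n) x).open_source.mem_nhds (mem_chart_source _ _)] with m hm
  rw [Sec.localRep, (chartAt (Coord n) x).left_inv hm]

theorem Sec.isCont_of_localRep {φ : L.Sec} (h : ∀ i, ∀ x ∈ L.base i,
    ContinuousAt (φ.localRep i x) (chartAt (Coord n) x x)) : φ.IsCont := fun i x hx =>
  ((h i x hx).comp ((chartAt (Coord n) x).continuousAt (mem_chart_source _ _))).congr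
    (φ.eventually_localRep i x)

theorem Sec.IsSmooth.isCont {φ : L.Sec} (h : φ.IsSmooth) : φ.IsCont :=
  Sec.isCont_of_localRep fun i x hx => (h i x hx).continuousAt

theorem Sec.IsConvex.isCont {φ : L.Sec} (h : φ.IsConvex) : φ.IsCont :=
  Sec.isCont_of_localRep fun i x hx =>
    let ⟨_, hV, hconv⟩ := h i x hx
    hconv.continuousOn_interior.continuousAt (interior_mem_nhds.2 hV)

theorem Sec.IsCont.continuous_diff {φ ψ : L.Sec} (hφ : φ.IsCont) (hψ : ψ.IsCont) :
    Continuous fun x => L.diff (φ.toFun x) (ψ.toFun x) := by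
  rw [continuous_iff_continuousAt]
  intro x
  have hi := L.mem_base_indexAt x
  refine ((hφ _ x hi).sub (hψ _ x hi)).congr ?_
  filter_upwards [(L.isOpen_base _).mem_nhds hi] with m hm
  rw [L.diff_eq (by rw [φ.proj_toFun, ψ.proj_toFun]) (by rw [φ.proj_toFun]; exact hm)]
  rfl

theorem Sec.IsCont.exists_bound [CompactSpace M] {φ ψ : L.Sec} (hφ : φ.IsCont) (hψ : ψ.IsCont) :
    ∃ C, ∀ x, |L.diff (φ.toFun x) (ψ.toFun x)| ≤ C := by
  obtain ⟨C, hC⟩ := isCompact_univ.exists_bound_of_continuousOn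
    (hφ.continuous_diff hψ).continuousOn
  exact ⟨C, fun x => hC x (mem_univ x)⟩

theorem Sec.Phi_eq_add (φ ψ : L.Sec) (q : L.AffSec P) (z : P.Space) :
    φ.Phi q z = L.diff (φ.toFun (P.π z)) (ψ.toFun (P.π z)) + ψ.Phi q z :=
  (L.diff_add_diff (by rw [φ.proj_toFun, ψ.proj_toFun])
    (by rw [ψ.proj_toFun, q.proj_toFun])).symm

/-- In the affine coordinates around `y`, the function `Φ_q` is the difference of the representative of
`φ` and of an affine function. -/
theorem Sec.eventually_Phi_eq (φ : L.Sec) (q : L.AffSec P) (y : P.Space) :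
    ∃ a : Coord n →ᵃ[ℝ] ℝ, ∀ᶠ z in 𝓝 y, φ.Phi q z =
      φ.localRep (L.indexAt (P.π y)) (P.π y) (chartAt (Coord n) (P.π y) (P.π z))
        - a (chartAt (Coord n) (P.π y) (P.π z)) := by
  have hi := L.mem_base_indexAt (P.π y)
  obtain ⟨a, ha⟩ := q.affine _ y hi
  have hπ := P.isCoveringMap.continuous.continuousAt (x := y)
  refine ⟨a, ?_⟩
  filter_upwards [ha, hπ.eventually (φ.eventually_localRep _ _),
    hπ.preimage_mem_nhds ((L.isOpen_base _).mem_nhds hi)] with z h1 h2 h3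
  rw [h2, ← h1, Sec.Phi, L.diff_eq (by rw [φ.proj_toFun, q.proj_toFun])
    (by rw [φ.proj_toFun]; exact h3)]

theorem Sec.IsCont.continuous_Phi {φ : L.Sec} (hφ : φ.IsCont) (q : L.AffSec P) :
    Continuous (φ.Phi q) := by
  rw [continuous_iff_continuousAt]
  intro y
  have hi := L.mem_base_indexAt (P.π y)
  obtain ⟨a, ha⟩ := q.affine _ y hi
  have hπ := P.isCoveringMap.continuous.continuousAt (x := y)
  have h1 := (hφ _ _ hi).comp hπ
  have h2 : ContinuousAt (fun z => a (chartAt (Coord n) (P.π y) (P.π z))) y :=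
    a.continuous_of_finiteDimensional.continuousAt.comp
      (((chartAt (Coord n) (P.π y)).continuousAt (mem_chart_source _ _)).comp hπ)
  refine (h1.sub h2).congr ?_
  filter_upwards [ha, hπ.preimage_mem_nhds ((L.isOpen_base _).mem_nhds hi)] with z h3 h4
  rw [Sec.Phi, L.diff_eq (by rw [φ.proj_toFun, q.proj_toFun])
    (by rw [φ.proj_toFun]; exact h4), h3]
  rfl

/-! ### Local regularity in the developing coordinates -/

variable {D : P.Space → Coord n}

theorem Sec.IsSmooth.locallyContDiff {φ : L.Sec} (hφ : φ.IsSmooth) (hD : P.IsDeveloping n D)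
    (q : L.AffSec P) : LocallyContDiff D (φ.Phi q) := by
  intro y
  obtain ⟨a, ha⟩ := φ.eventually_Phi_eq q y
  obtain ⟨A, hA⟩ := hD y
  have hAs : ContDiff ℝ 1 A.symm := A.symm.toContinuousAffineEquiv.toContinuousAffineMap.contDiff
  have has : ContDiff ℝ 1 a := ContinuousAffineMap.contDiff ⟨a, a.continuous_of_finiteDimensional⟩
  refine ⟨fun u => φ.localRep (L.indexAt (P.π y)) (P.π y) (A.symm u) - a (A.symm u), ?_, ?_⟩
  · refine ContDiffAt.sub (ContDiffAt.comp (g := φ.localRep (L.indexAt (P.π y)) (P.π y))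
      (f := A.symm) _ ?_ hAs.contDiffAt) (has.comp hAs).contDiffAt
    rw [hA.self_of_nhds, A.symm_apply_apply]
    exact (hφ _ _ (L.mem_base_indexAt _)).of_le (by norm_cast)
  · filter_upwards [ha, hA] with z h1 h2
    rw [h1, h2, A.symm_apply_apply]

theorem Sec.IsStrictConvex.locallyStrictConvex {φ : L.Sec} (hφ : φ.IsStrictConvex)
    (hD : P.IsDeveloping n D) (q : L.AffSec P) : LocallyStrictConvex D (φ.Phi q) := by
  intro y
  obtain ⟨a, ha⟩ := φ.eventually_Phi_eq q y
  obtain ⟨A, hA⟩ := hD y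
  obtain ⟨V, hV, hconv⟩ := hφ _ _ (L.mem_base_indexAt (P.π y))
  have hAV : A.symm ⁻¹' V ∈ 𝓝 (D y) := by
    refine A.symm.toAffineMap.continuous_of_finiteDimensional.continuousAt.preimage_mem_nhds ?_
    rw [hA.self_of_nhds]
    change V ∈ 𝓝 (A.symm (A _))
    rwa [A.symm_apply_apply]
  obtain ⟨ε, hε, hball⟩ := Metric.nhds_basis_ball.mem_iff.1 hAV
  refine ⟨fun u => φ.localRep (L.indexAt (P.π y)) (P.π y) (A.symm u) - a (A.symm u),
    ⟨ε, hε, convex_ball _ _, fun p hp r hr hpr s t hs ht hst => ?_⟩, ?_⟩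
  · have h1 : A.symm (s • p + t • r) = s • A.symm p + t • A.symm r :=
      Convex.combo_affine_apply (f := A.symm.toAffineMap) hst
    have h2 : a (s • A.symm p + t • A.symm r) = s • a (A.symm p) + t • a (A.symm r) :=
      Convex.combo_affine_apply hst
    have h3 := hconv.2 (hball hp) (hball hr) (fun h => hpr (A.symm.injective h)) hs ht hst
    simp only [h1, h2, smul_eq_mul] at h3 ⊢
    linarith
  · filter_upwards [ha, hA] with z h1 h2
    rw [h1, h2, A.symm_apply_apply]

/-- The section `π*φ` is invariant under deck transformations, so the change of `Φ_q` is the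
difference of two affine sections. Second differences do not see it. -/
theorem Sec.exists_Phi_deck (φ : L.Sec) (hD : P.IsDeveloping n D) (q : L.AffSec P) (γ : P.deck) :
    ∃ a : Coord n →ᵃ[ℝ] ℝ, ∀ z, φ.Phi q (γ.1 z) = φ.Phi q z + a (D z) := by
  obtain ⟨a, ha⟩ := hD.exists_eq_comp (isLocallyAffine_diff q (γ⁻¹ • q))
  refine ⟨a, fun z => ?_⟩
  have h1 : φ.Phi (γ⁻¹ • q) z = φ.Phi q (γ.1 z) := by
    rw [Sec.Phi_smul, inv_inv]
    rfl
  rw [← h1, ← ha]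
  exact (L.diff_add_diff (by rw [φ.proj_toFun, q.proj_toFun])
    (by rw [q.proj_toFun, (γ⁻¹ • q).proj_toFun])).symm

/-- The holonomy distorts the norm of `ℝⁿ`. The free linear map `A` in `MidpointGap` absorbs its
linear part, so the same `δ` works along a whole orbit. -/
theorem Sec.midpointGap_deck (φ : L.Sec) (hD : P.IsDeveloping n D) (q : L.AffSec P) (γ : P.deck)
    {δ : ℝ} {y : P.Space} (h : MidpointGap D (φ.Phi q) δ y) : MidpointGap D (φ.Phi q) δ (γ.1 y) := by
  obtain ⟨A, W, s, hW, hgap⟩ := h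
  obtain ⟨B, hB⟩ := hD.exists_deck_linear γ
  obtain ⟨a, ha⟩ := φ.exists_Phi_deck hD q γ
  have hBc : Continuous B.symm := B.symm.toAffineMap.continuous_of_finiteDimensional
  have hplus : ∀ v, B.symm (B (D y) + B.linear v) = D y + v := by
    intro v
    rw [B.symm_apply_eq, add_comm, add_comm (D y)]
    exact (B.map_vadd (D y) v).symm
  refine ⟨A.trans B.linear, B.symm ⁻¹' W, fun u => γ.1 (s (B.symm u)),
    ⟨hW.isOpen.preimage hBc, hW.convex.affine_preimage B.symm.toAffineMap, ?_, ?_, ?_, ?_⟩,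
    fun w hw => ?_⟩
  · rw [hB, mem_preimage, B.symm_apply_apply]
    exact hW.mem
  · exact γ.1.continuous.comp_continuousOn (hW.continuousOn.comp hBc.continuousOn fun u hu => hu)
  · rw [hB, B.symm_apply_apply, hW.apply_self]
  · intro u hu
    rw [hB, hW.right_inv _ hu, B.apply_symm_apply]
  · obtain ⟨h1, h2, h3⟩ := hgap w hw
    have e1 : B.symm (D (γ.1 y) + (A.trans B.linear) w) = D y + A w := by
      rw [hB]; exact hplus _
    have e2 : B.symm (D (γ.1 y) - (A.trans B.linear) w) = D y - A w := by
      rw [hB, sub_eq_add_neg, ← map_neg, sub_eq_add_neg, ← map_neg]; exact hplus _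
    simp only [mem_preimage, e1, e2]
    refine ⟨h1, h2, ?_⟩
    rw [ha, ha, ha, hW.right_inv _ h1, hW.right_inv _ h2]
    have h4 : a (D y + A w) + a (D y - A w) = 2 * a (D y) := by
      have e3 : a (D y + A w) = a.linear (A w) + a (D y) := by
        rw [add_comm]; exact a.map_vadd (D y) (A w)
      have e4 : a (D y - A w) = a.linear (-A w) + a (D y) := by
        rw [sub_eq_add_neg, add_comm]; exact a.map_vadd (D y) (-A w)
      rw [e3, e4, map_neg]
      ring
    linarith

/-- Local gaps are constant along fibres of `π`, so the compactness of `M` yields a single one. -/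
theorem Sec.IsStrictConvex.uniformlyMidpointConvex [CompactSpace M] {φ : L.Sec}
    (hφ : φ.IsStrictConvex) (hφc : φ.IsCont) (hD : P.IsDeveloping n D) (q : L.AffSec P) :
    UniformlyMidpointConvex D (φ.Phi q) := by
  have := P.locallyPathConnectedSpace n
  have hmono : ∀ {δ δ' : ℝ} {y : P.Space}, δ' ≤ δ → MidpointGap D (φ.Phi q) δ y →
      MidpointGap D (φ.Phi q) δ' y := by
    rintro δ δ' y hδ ⟨A, W, s, hW, h⟩
    refine ⟨A, W, s, hW, fun w hw => ?_⟩
    obtain ⟨h1, h2, h3⟩ := h w hw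
    exact ⟨h1, h2, by linarith⟩
  have key : ∃ δ : ℝ, 0 < δ ∧ ∀ y, P.π y ∈ (univ : Set M) → MidpointGap D (φ.Phi q) δ y := by
    refine isCompact_univ.induction_on (p := fun S : Set M => ∃ δ : ℝ, 0 < δ ∧
      ∀ y, P.π y ∈ S → MidpointGap D (φ.Phi q) δ y) ⟨1, one_pos, by simp⟩ ?_ ?_ ?_
    · rintro S S' hS ⟨δ, hδ, h⟩
      exact ⟨δ, hδ, fun y hy => h y (hS hy)⟩
    · rintro S S' ⟨δ, hδ, h⟩ ⟨δ', hδ', h'⟩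
      refine ⟨min δ δ', lt_min hδ hδ', fun y hy => ?_⟩
      rcases hy with hy | hy
      · exact hmono (min_le_left _ _) (h y hy)
      · exact hmono (min_le_right _ _) (h' y hy)
    · intro x _
      obtain ⟨y, rfl⟩ := P.surjective x
      obtain ⟨δ, hδ, hN⟩ := (hφ.locallyStrictConvex hD q).eventually_midpointGap
        hD.isLocalHomeomorph (hφc.continuous_Phi q) y
      refine ⟨P.π '' {z | MidpointGap D (φ.Phi q) δ z}, ?_, δ, hδ, ?_⟩
      · rw [nhdsWithin_univ]
        exact P.isCoveringMap.isOpenMap.image_mem_nhds hN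
      · rintro z ⟨z', hz', hzz⟩
        obtain ⟨γ, rfl⟩ := P.exists_deck hzz
        exact φ.midpointGap_deck hD q γ hz'
  obtain ⟨δ, hδ, h⟩ := key
  exact ⟨δ, hδ, fun y => h y (mem_univ _)⟩

end AffineRBundle

namespace AffineRBundle

variable {n : ℕ} {M : Type u} [TopologicalSpace M] [ChartedSpace (Coord n) M]
  {L : AffineRBundle.{u, v, w} n M} {P : UniversalCovering.{u, t} M} {D : P.Space → Coord n}

/-! ### Tangent affine sections -/

theorem Sec.isTangentAt_iff (φ : L.Sec) (hD : P.IsDeveloping n D) (q : L.AffSec P) (y : P.Space) :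
    φ.IsTangentAt q y ↔ φ.Phi q =o[𝓝 y] fun z => D z - D y := by
  obtain ⟨A, hA⟩ := hD y
  have key : ∀ᶠ z in 𝓝 y, D z - D y = A.linear.toContinuousLinearEquiv
      (chartAt (Coord n) (P.π y) (P.π z) - chartAt (Coord n) (P.π y) (P.π y)) := by
    filter_upwards [hA] with z hz
    rw [hz, hA.self_of_nhds]
    exact (A.toAffineMap.linearMap_vsub _ _).symm
  have h1 : (fun z => D z - D y) =O[𝓝 y] fun z =>
      chartAt (Coord n) (P.π y) (P.π z) - chartAt (Coord n) (P.π y) (P.π y) :=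
    ((A.linear.toContinuousLinearEquiv : Coord n →L[ℝ] Coord n).isBigO_comp _ _).congr'
      (key.mono fun _ h => h.symm) EventuallyEq.rfl
  have h2 : (fun z => chartAt (Coord n) (P.π y) (P.π z) - chartAt (Coord n) (P.π y) (P.π y))
      =O[𝓝 y] fun z => D z - D y :=
    ((A.linear.toContinuousLinearEquiv.symm : Coord n →L[ℝ] Coord n).isBigO_comp
      (fun z => D z - D y) (𝓝 y)).congr' (key.mono fun z h => by
        change A.linear.toContinuousLinearEquiv.symm (D z - D y) = _
        rw [h, ContinuousLinearEquiv.symm_apply_apply]) EventuallyEq.rfl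
  exact ⟨fun h => h.trans_isBigO h2, fun h => h.trans_isBigO h1⟩

theorem Sec.IsTangentAt.smul {φ : L.Sec} {q : L.AffSec P} {y : P.Space} (h : φ.IsTangentAt q y)
    (γ : P.deck) : φ.IsTangentAt (γ • q) (γ.1 y) := by
  have hy : (γ⁻¹ : P.deck).1 (γ.1 y) = y := γ.1.symm_apply_apply y
  have h1 : Tendsto (γ⁻¹ : P.deck).1 (𝓝 (γ.1 y)) (𝓝 y) := by
    have := (γ⁻¹ : P.deck).1.continuous.tendsto (γ.1 y)
    rwa [hy] at this
  have h2 := h.comp_tendsto h1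
  rw [Sec.IsTangentAt, Sec.Phi_smul, γ.2]
  refine h2.congr_right fun z => ?_
  rw [Function.comp, P.π_inv]

theorem AffSec.ext_of_diff {q q' : L.AffSec P} (h : ∀ z, L.diff (q.toFun z) (q'.toFun z) = 0) :
    q = q' := by
  refine AffSec.ext (funext fun z => ?_)
  have hz := h z
  have hi := L.mem_base_indexAt (P.π z)
  have hq : L.proj (q.toFun z) ∈ L.base (L.indexAt (P.π z)) := by rwa [q.proj_toFun]
  have hqq : L.proj (q.toFun z) = L.proj (q'.toFun z) := by rw [q.proj_toFun, q'.proj_toFun]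
  rw [L.diff_eq hqq hq] at hz
  exact L.ext_coord hqq hq (sub_eq_zero.1 hz)

theorem _root_.AffineMap.eq_zero_of_isLittleO {E : Type*} [NormedAddCommGroup E] [NormedSpace ℝ E]
    [FiniteDimensional ℝ E] {a : E →ᵃ[ℝ] ℝ} {p : E} (h : a =o[𝓝 p] fun u => u - p) : a = 0 := by
  have h0 : a p = 0 := by simpa using (h.def one_pos).self_of_nhds
  have h1 : HasFDerivAt a (0 : E →L[ℝ] ℝ) p := by
    rw [hasFDerivAt_iff_isLittleO]
    simpa [h0] using h
  have h2 : HasFDerivAt a (LinearMap.toContinuousLinearMap a.linear) p := by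
    have := (LinearMap.toContinuousLinearMap a.linear).hasFDerivAt (x := p) |>.add_const (a 0)
    refine this.congr_of_eventuallyEq (Eventually.of_forall fun u => ?_)
    exact congrFun a.decomp u
  have h3 : a.linear = 0 := by
    have := h2.unique h1
    ext u
    exact congrArg (fun l : E →L[ℝ] ℝ => l u) this
  ext u
  have h4 := a.map_vadd p (u - p)
  rw [h3, h0] at h4
  simpa using h4

/-- The difference of two tangent sections is an affine function of `D` that vanishes to first order
at a point. -/
theorem Sec.IsTangentAt.unique {φ : L.Sec} (hD : P.IsDeveloping n D) {q q' : L.AffSec P}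
    {y : P.Space} (h : φ.IsTangentAt q y) (h' : φ.IsTangentAt q' y) : q = q' := by
  rw [φ.isTangentAt_iff hD] at h h'
  obtain ⟨a, ha⟩ := hD.exists_eq_comp (isLocallyAffine_diff q q')
  have h1 : (fun z => a (D z)) =o[𝓝 y] fun z => D z - D y := by
    refine (h'.sub h).congr_left fun z => ?_
    have h1 := L.diff_add_diff (a := φ.toFun (P.π z)) (b := q.toFun z) (c := q'.toFun z)
      (by rw [φ.proj_toFun, q.proj_toFun]) (by rw [q.proj_toFun, q'.proj_toFun])
    rw [← ha, Sec.Phi, Sec.Phi, ← h1, add_sub_cancel_left]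
  have h2 : a =o[𝓝 (D y)] fun u => u - D y := by
    rw [← hD.isLocalHomeomorph.map_nhds_eq, Asymptotics.isLittleO_map]
    exact h1
  refine AffSec.ext_of_diff fun z => ?_
  rw [ha, AffineMap.eq_zero_of_isLittleO h2]
  rfl

theorem continuous_affSec_of_forall {X : Type*} [TopologicalSpace X] {τ : X → L.AffSec P}
    (h : ∀ z, Continuous fun x => L.coordAt (P.π z) ((τ x).toFun z)) : Continuous τ :=
  continuous_induced_rng.2 (continuous_pi h)

theorem continuous_affSec_apply (z : P.Space) :
    Continuous fun q : L.AffSec P => L.coordAt (P.π z) (q.toFun z) := by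
  have h : Continuous fun (q : L.AffSec P) (y : P.Space) => L.coordAt (P.π y) (q.toFun y) :=
    continuous_induced_dom
  exact (continuous_apply z).comp h

/-- The evaluation of affine sections is jointly continuous. -/
theorem continuous_diff_affSec (hD : P.IsDeveloping n D) (q₀ : L.AffSec P) :
    Continuous fun p : L.AffSec P × P.Space => L.diff (p.1.toFun p.2) (q₀.toFun p.2) := by
  -- The image of `D` is open, so it contains an affine basis. Barycentric coordinates then express
  -- evaluation anywhere through evaluation at finitely many fixed points of `Ω`.
  obtain ⟨s, hs, hspan, hind⟩ := exists_affineIndependent ℝ (Coord n) (range D)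
  have htop : affineSpan ℝ s = ⊤ := hspan.trans
    (hD.isLocalHomeomorph.isOpenMap.isOpen_range.affineSpan_eq_top (range_nonempty D))
  let b : AffineBasis s ℝ (Coord n) := ⟨(↑), hind, by rwa [Subtype.range_coe]⟩
  have : Finite s := finite_set_of_fin_dim_affineIndependent ℝ hind
  have := Fintype.ofFinite s
  choose z hz using fun i : s => hs i.2
  have hsum : ∀ (q : L.AffSec P) (x : P.Space), L.diff (q.toFun x) (q₀.toFun x)
      = ∑ i, b.coord i (D x) * L.diff (q.toFun (z i)) (q₀.toFun (z i)) := by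
    intro q x
    obtain ⟨a, ha⟩ := hD.exists_eq_comp (isLocallyAffine_diff q q₀)
    have h1 := congrArg a (b.affineCombination_coord_eq_self (D x))
    rw [Finset.map_affineCombination _ _ _ (b.sum_coord_apply_eq_one _),
      Finset.affineCombination_eq_linear_combination _ _ _ (b.sum_coord_apply_eq_one _)] at h1
    rw [ha, ← h1]
    refine Finset.sum_congr rfl fun i _ => ?_
    rw [ha, hz]
    rfl
  refine (continuous_congr fun p : L.AffSec P × P.Space => hsum p.1 p.2).2 ?_
  refine continuous_finsetSum _ fun i _ => ?_
  have h1 : Continuous fun q : L.AffSec P => L.diff (q.toFun (z i)) (q₀.toFun (z i)) := by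
    have h2 : ∀ q : L.AffSec P, L.diff (q.toFun (z i)) (q₀.toFun (z i))
        = L.coordAt (P.π (z i)) (q.toFun (z i)) - L.coordAt (P.π (z i)) (q₀.toFun (z i)) := fun q =>
      L.diff_eq (by rw [q.proj_toFun, q₀.proj_toFun])
        (by rw [q.proj_toFun]; exact L.mem_base_indexAt _)
    simp only [h2]
    exact (continuous_affSec_apply (z i)).sub continuous_const
  exact (((b.coord i).continuous_of_finiteDimensional.comp hD.isLocalHomeomorph.continuous).comp
    continuous_snd).mul (h1.comp continuous_fst)

theorem Sec.IsCont.continuous_Phi_uncurry {φ : L.Sec} (hφ : φ.IsCont) (hD : P.IsDeveloping n D)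
    (q₀ : L.AffSec P) : Continuous fun p : L.AffSec P × P.Space => φ.Phi p.1 p.2 := by
  have h : ∀ p : L.AffSec P × P.Space,
      φ.Phi p.1 p.2 = φ.Phi q₀ p.2 - L.diff (p.1.toFun p.2) (q₀.toFun p.2) := fun p => by
    rw [eq_sub_iff_add_eq]
    exact L.diff_add_diff (by rw [φ.proj_toFun, p.1.proj_toFun])
      (by rw [p.1.proj_toFun, q₀.proj_toFun])
  simp only [h]
  exact ((hφ.continuous_Phi q₀).comp continuous_snd).sub (continuous_diff_affSec hD q₀)

/-- To any affine section `q` one adds the first order Taylor polynomial of `Φ_q` at `y`, taken in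
the coordinate `D`. It varies continuously with `y`. -/
theorem Sec.IsSmooth.exists_isTangentAt [IsAffineManifold n M] {φ : L.Sec} (hφ : φ.IsSmooth)
    (hD : P.IsDeveloping n D) : ∃ τ : P.Space → L.AffSec P, Continuous τ ∧
      (Continuous fun p : P.Space × P.Space => φ.Phi (τ p.1) p.2) ∧
        ∀ y, φ.IsTangentAt (τ y) y := by
  obtain ⟨q, -⟩ := L.exists_affSec P (Classical.arbitrary _) 0
  obtain ⟨l, hl, hlo⟩ := (hφ.locallyContDiff hD q).exists_slope hD.isLocalHomeomorph
  have hDc := hD.isLocalHomeomorph.continuous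
  have hqc := hφ.isCont.continuous_Phi q
  let a : P.Space → Coord n →ᵃ[ℝ] ℝ := fun y =>
    (l y).toLinearMap.toAffineMap + AffineMap.const ℝ (Coord n) (φ.Phi q y - l y (D y))
  have ha : ∀ y u, a y u = φ.Phi q y + l y (u - D y) := by
    intro y u
    change l y u + (φ.Phi q y - l y (D y)) = _
    rw [map_sub]
    ring
  refine ⟨fun y => q.addComp hD (a y), continuous_affSec_of_forall fun z => ?_, ?_, fun y => ?_⟩
  · have h1 : ∀ y, L.coordAt (P.π z) ((q.addComp hD (a y)).toFun z)
        = (φ.Phi q y + l y (D z - D y)) + L.coordAt (P.π z) (q.toFun z) := by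
      intro y
      rw [← ha]
      exact L.coord_vadd _ _ (by rw [q.proj_toFun]; exact L.mem_base_indexAt _)
    simp only [h1]
    exact (hqc.add (hl.clm_apply (continuous_const.sub hDc))).add continuous_const
  · simp only [Sec.Phi_addComp, ha]
    exact (hqc.comp continuous_snd).sub ((hqc.comp continuous_fst).add
      ((hl.comp continuous_fst).clm_apply
        ((hDc.comp continuous_snd).sub (hDc.comp continuous_fst))))
  · rw [φ.isTangentAt_iff hD]
    refine (hlo y).congr_left fun z => ?_
    rw [φ.Phi_addComp, ha]

/-! ### The dual of `K*` -/

/-- Every `q ∈ K*` has compact sublevel sets, with respect to every continuous section. -/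
theorem Sec.IsCont.isCompact_sublevel [CompactSpace M] {φ : L.Sec} (hφ : φ.IsCont)
    (q : L.Kstar P) (c : ℝ) : IsCompact {z | φ.Phi q.1 z ≤ c} := by
  obtain ⟨ψ, hψ, ⟨m, hm⟩, hp⟩ := q.2
  obtain ⟨C, hC⟩ := hψ.1.isCont.exists_bound hφ
  refine (hp.isCompact_preimage (isCompact_Icc (a := m) (b := C + c))).of_isClosed_subset
    (isClosed_le (hφ.continuous_Phi q.1) continuous_const) fun z hz => ⟨hm (mem_range_self z), ?_⟩
  rw [ψ.Phi_eq_add φ]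
  exact add_le_add (le_of_abs_le (hC _)) hz

/-- Over a compact base, changing the section changes `Φ_q` by a bounded function only. -/
theorem mem_Kstar_of_isCompact_sublevel [CompactSpace M] (hL : L.IsHessian) {φ : L.Sec}
    (hφ : φ.IsCont) {q : L.AffSec P} {m : ℝ} (hm : ∀ z, m ≤ φ.Phi q z)
    (hc : ∀ c, IsCompact {z | φ.Phi q z ≤ c}) : q ∈ L.Kstar P := by
  obtain ⟨ψ, hψ⟩ := hL
  obtain ⟨C, hC⟩ := hψ.1.isCont.exists_bound hφ
  have hψc := hψ.1.isCont.continuous_Phi q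
  have hle : ∀ z, φ.Phi q z - C ≤ ψ.Phi q z := fun z => by
    rw [ψ.Phi_eq_add φ]
    linarith [neg_le_of_abs_le (hC (P.π z))]
  refine ⟨ψ, hψ, ⟨m - C, ?_⟩, isProperMap_of_isCompact_sublevel hψc fun c => ?_⟩
  · rintro _ ⟨z, rfl⟩
    linarith [hle z, hm z]
  · refine (hc (c + C)).of_isClosed_subset (isClosed_le hψc continuous_const) fun z hz => ?_
    have : ψ.Phi q z ≤ c := hz
    change φ.Phi q z ≤ c + C
    linarith [hle z]

/-- The family `τ` of the affine sections tangent to `π*φ` parametrizes `K*` modulo `ℝ`. -/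
structure Sec.IsTangentFamily (φ : L.Sec) (τ : P.Space → L.Kstar P) : Prop where
  continuous : Continuous τ
  continuous_Phi : Continuous fun p : P.Space × P.Space => φ.Phi (τ p.1).1 p.2
  isTangentAt : ∀ y, φ.IsTangentAt (τ y).1 y
  unique : ∀ y q, φ.IsTangentAt q y → q = (τ y).1
  apply_self : ∀ y, φ.Phi (τ y).1 y = 0
  pos : ∀ y z, z ≠ y → 0 < φ.Phi (τ y).1 z
  exists_vadd_eq : ∀ q, ∃ (C : ℝ) (y : P.Space), C +ᵥ q = τ y

/-- The global growth results for locally and uniformly strictly convex functions apply to `Φ_q` for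
`q` tangent at `y`: they give positivity away from `y`, and compact sublevel sets, hence membership
in `K*`. -/
theorem Sec.IsSmooth.exists_isTangentFamily [T2Space M] [CompactSpace M] [IsAffineManifold n M]
    (hL : L.IsHessian) (P : UniversalCovering.{u, t} M) {φ : L.Sec} (hφ : φ.IsSmooth)
    (hφ' : φ.IsStrictConvex) : ∃ τ : P.Space → L.Kstar P, φ.IsTangentFamily τ := by
  have := P.t2Space
  obtain ⟨D, hD⟩ := L.exists_isDeveloping P
  obtain ⟨τ, hτ, hτc, hτt⟩ := hφ.exists_isTangentAt (L := L) hD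
  have hlh := hD.isLocalHomeomorph
  have hΦc := fun q : L.AffSec P => hφ.isCont.continuous_Phi q
  have hconv := fun q : L.AffSec P => hφ'.locallyStrictConvex hD q
  have humc := fun q : L.AffSec P => hφ'.uniformlyMidpointConvex hφ.isCont hD q
  have hcrit := fun y => (φ.isTangentAt_iff hD _ _).1 (hτt y)
  have h0 : ∀ y, φ.Phi (τ y) y = 0 := fun y => apply_eq_zero_of_isLittleO (hcrit y)
  have hpos : ∀ y z, z ≠ y → 0 < φ.Phi (τ y) z := fun y z hz =>
    pos_of_isLittleO hlh (hΦc _) (hconv _) (humc _) (hcrit y) hz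
  have hmem : ∀ y, τ y ∈ L.Kstar P := fun y => by
    refine mem_Kstar_of_isCompact_sublevel hL hφ.isCont (m := 0) (fun z => ?_) fun c =>
      isCompact_sublevel_of_isLittleO hlh (hΦc _) (hconv _) (humc _) (hcrit y) c
    rcases eq_or_ne z y with rfl | hz
    · exact (h0 z).ge
    · exact (hpos y z hz).le
  refine ⟨fun y => ⟨τ y, hmem y⟩, hτ.subtype_mk _, hτc, hτt, fun y q hq => hq.unique hD (hτt y), h0,
    hpos, fun q => ?_⟩
  let z₀ : P.Space := Classical.arbitrary _
  -- For `q ∈ K*` the function `Φ_q` attains its minimum. Adding the minimal value to `q` makes it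
  -- tangent at the minimum point.
  obtain ⟨y, hy, hmin⟩ := (hφ.isCont.isCompact_sublevel q (φ.Phi q.1 z₀)).exists_isMinOn
    ⟨z₀, le_refl (φ.Phi q.1 z₀)⟩ (hΦc q.1).continuousOn
  have hmin' : ∀ z, φ.Phi q.1 y ≤ φ.Phi q.1 z := fun z => by
    rcases le_total (φ.Phi q.1 z) (φ.Phi q.1 z₀) with h | h
    · exact hmin h
    · exact le_trans hy h
  refine ⟨φ.Phi q.1 y, y, Subtype.ext (IsTangentAt.unique (φ := φ) hD (y := y) ?_ (hτt y))⟩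
  change φ.IsTangentAt (φ.Phi q.1 y +ᵥ q.1) y
  rw [φ.isTangentAt_iff hD, φ.Phi_vadd]
  exact (hφ.locallyContDiff hD q.1).isLittleO_of_isLocalMin hlh (Eventually.of_forall hmin')

/-! ### The mutually inverse maps `dφ` and `T_φ`. -/

theorem toMstar_eq_iff {q q' : L.Kstar P} :
    toMstar q = toMstar q' ↔ ∃ (γ : P.deck) (C : ℝ), q' = γ • (C +ᵥ q) := by
  constructor
  · intro h
    obtain ⟨γ, hγ⟩ : ∃ γ : P.deck, γ • (Quotient.mk'' q : L.OmegaStar P) = Quotient.mk'' q' :=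
      MulAction.mem_orbit_iff.1 (MulAction.orbitRel_apply.1 (Quotient.eq''.1 h.symm))
    obtain ⟨C, hC⟩ : ∃ C : ℝ, C +ᵥ (γ • q) = q' :=
      AddAction.mem_orbit_iff.1 (AddAction.orbitRel_apply.1 (Quotient.eq''.1 hγ.symm))
    exact ⟨γ, C, hC.symm⟩
  · rintro ⟨γ, C, rfl⟩
    refine Quotient.eq''.2 (MulAction.orbitRel_apply.2 (MulAction.mem_orbit_iff.2 ⟨γ⁻¹, ?_⟩))
    refine Quotient.eq''.2 (AddAction.orbitRel_apply.2 (AddAction.mem_orbit_iff.2 ⟨C, ?_⟩))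
    exact (inv_smul_smul γ (C +ᵥ q)).symm

theorem isQuotientMap_toMstar : IsQuotientMap (toMstar : L.Kstar P → L.Mstar P) :=
  (isQuotientMap_quotient_mk' (X := L.OmegaStar P)).comp isQuotientMap_quotient_mk'

namespace Sec.IsTangentFamily

variable {φ : L.Sec} {τ : P.Space → L.Kstar P}

theorem nonneg (h : φ.IsTangentFamily τ) (y z : P.Space) : 0 ≤ φ.Phi (τ y).1 z := by
  rcases eq_or_ne z y with rfl | hz
  · exact (h.apply_self z).ge
  · exact (h.pos y z hz).le

theorem smul_eq (h : φ.IsTangentFamily τ) (γ : P.deck) (y : P.Space) : γ • τ y = τ (γ.1 y) :=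
  Subtype.ext (h.unique _ _ ((h.isTangentAt y).smul γ))

theorem Phi_deck (h : φ.IsTangentFamily τ) (γ : P.deck) (y z : P.Space) :
    φ.Phi (τ (γ.1 y)).1 z = φ.Phi (τ y).1 ((γ⁻¹ : P.deck).1 z) := by
  rw [← h.smul_eq]
  exact congrFun (φ.Phi_smul γ (τ y).1) z

end Sec.IsTangentFamily

/-- The map `dφ`, given by a family of tangent affine sections. -/
def dualMap (τ : P.Space → L.Kstar P) (x : M) : L.Mstar P :=
  toMstar (τ (Function.surjInv P.surjective x))

namespace Sec.IsTangentFamily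

variable {φ : L.Sec} {τ : P.Space → L.Kstar P} [LocallyPathConnectedSpace P.Space]

theorem dualMap_π (h : φ.IsTangentFamily τ) (y : P.Space) : dualMap τ (P.π y) = toMstar (τ y) := by
  obtain ⟨γ, hγ⟩ := P.exists_deck (Function.surjInv_eq P.surjective (P.π y))
  refine toMstar_eq_iff.2 ⟨γ, 0, ?_⟩
  rw [zero_vadd, h.smul_eq, hγ]

theorem isDifferentialAt_iff (h : φ.IsTangentFamily τ) (x : M) (p : L.Mstar P) :
    φ.IsDifferentialAt x p ↔ dualMap τ x = p := by
  constructor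
  · rintro ⟨y, rfl, q, hq, rfl⟩
    rw [h.dualMap_π, ← Subtype.ext (h.unique _ _ hq)]
  · rintro rfl
    obtain ⟨y, rfl⟩ := P.surjective x
    exact ⟨y, rfl, τ y, h.isTangentAt y, (h.dualMap_π y).symm⟩

theorem continuous_dualMap (h : φ.IsTangentFamily τ) : Continuous (dualMap τ) := by
  rw [(P.isCoveringMap.isQuotientMap P.surjective).continuous_iff]
  exact (isQuotientMap_toMstar.continuous.comp h.continuous).congr fun y => (h.dualMap_π y).symm

/-- If the tangent sections at two distinct points of `Ω` differed by a constant `C`, positivity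
evaluated at each point would give both `C > 0` and `C < 0`. -/
theorem dualMap_injective (h : φ.IsTangentFamily τ) : Function.Injective (dualMap τ) := by
  intro x x' hxx
  obtain ⟨y, rfl⟩ := P.surjective x
  obtain ⟨y', rfl⟩ := P.surjective x'
  rw [h.dualMap_π, h.dualMap_π, toMstar_eq_iff] at hxx
  obtain ⟨γ, C, hC⟩ := hxx
  have hC' : τ y' = C +ᵥ τ (γ.1 y) := by rw [← h.smul_eq]; exact hC
  have h1 : ∀ z, φ.Phi (τ y').1 z = φ.Phi (τ (γ.1 y)).1 z - C := fun z => by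
    rw [hC']
    exact congrFun (φ.Phi_vadd C (τ (γ.1 y)).1) z
  have h2 := h1 y'
  have h3 := h1 (γ.1 y)
  rw [h.apply_self] at h2 h3
  by_contra hne
  have hne' : y' ≠ γ.1 y := by
    rintro rfl
    exact hne (γ.2 y).symm
  linarith [h.pos _ _ hne', h.pos _ _ hne'.symm]

theorem isInverseDifferentialAt_iff (h : φ.IsTangentFamily τ) (x : M) (p : L.Mstar P) :
    φ.IsInverseDifferentialAt p x ↔ dualMap τ x = p := by
  constructor
  · rintro ⟨q, rfl, y, rfl, hy⟩
    obtain ⟨C, y', hC⟩ := h.exists_vadd_eq q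
    have h1 : ∀ z, φ.Phi (τ y').1 z = φ.Phi q.1 z - C := fun z => by
      rw [← hC]
      exact congrFun (φ.Phi_vadd C q.1) z
    have hyy : y = y' := by
      by_contra hne
      have := hy y' (Ne.symm hne)
      have h2 := h.pos y' y hne
      have h3 := h.apply_self y'
      rw [h1] at h2 h3
      linarith
    rw [hyy, h.dualMap_π, ← hC]
    refine (toMstar_eq_iff.2 ⟨1, C, (one_smul _ _).symm⟩).symm
  · rintro rfl
    obtain ⟨y, rfl⟩ := P.surjective x
    refine ⟨τ y, (h.dualMap_π y).symm, y, rfl, fun z hz => ?_⟩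
    rw [h.apply_self]
    exact h.pos y z hz

theorem dualMap_inverseDifferential (h : φ.IsTangentFamily τ) (p : L.Mstar P) :
    dualMap τ (φ.inverseDifferential p) = p := by
  have hex : ∃ x, φ.IsInverseDifferentialAt p x := by
    obtain ⟨q, rfl⟩ := toMstar_surjective p
    obtain ⟨C, y, hC⟩ := h.exists_vadd_eq q
    refine ⟨P.π y, (h.isInverseDifferentialAt_iff _ _).2 ?_⟩
    rw [h.dualMap_π, ← hC]
    exact (toMstar_eq_iff.2 ⟨1, C, (one_smul _ _).symm⟩).symm
  rw [Sec.inverseDifferential, dif_pos hex]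
  exact (h.isInverseDifferentialAt_iff _ _).1 hex.choose_spec

theorem inverseDifferential_dualMap (h : φ.IsTangentFamily τ) (x : M) :
    φ.inverseDifferential (dualMap τ x) = x :=
  h.dualMap_injective (h.dualMap_inverseDifferential _)

theorem inverseDifferential_of_vadd_eq (h : φ.IsTangentFamily τ) {q : L.Kstar P} {C : ℝ}
    {y : P.Space} (hC : C +ᵥ q = τ y) : φ.inverseDifferential (toMstar q) = P.π y := by
  rw [← h.inverseDifferential_dualMap (P.π y), h.dualMap_π, ← hC]
  exact congrArg _ (toMstar_eq_iff.2 ⟨1, C, (one_smul _ _).symm⟩)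

/-- The map `T_φ` is continuous: the minimum of `Φ_q` depends continuously on `q`. -/
theorem continuous_inverseDifferential (h : φ.IsTangentFamily τ) (hφ : φ.IsSmooth)
    (hD : P.IsDeveloping n D) : Continuous (φ.inverseDifferential (P := P)) := by
  have hlh := hD.isLocalHomeomorph
  rw [isQuotientMap_toMstar.continuous_iff, continuous_iff_continuousAt]
  intro q₀
  obtain ⟨C, y₀, hC⟩ := h.exists_vadd_eq q₀
  have hΦ : ∀ z, φ.Phi (τ y₀).1 z = φ.Phi q₀.1 z - C := fun z => by
    rw [← hC]
    exact congrFun (φ.Phi_vadd C q₀.1) z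
  rw [ContinuousAt, Function.comp, h.inverseDifferential_of_vadd_eq hC]
  intro W hW
  obtain ⟨U, s, hU⟩ := hlh.exists_isConvexSection y₀
  have hsW : s ⁻¹' (P.π ⁻¹' W) ∩ U ∈ 𝓝 (D y₀) := by
    refine inter_mem ?_ (hU.isOpen.mem_nhds hU.mem)
    refine (hU.continuousOn.continuousAt (hU.isOpen.mem_nhds hU.mem)).preimage_mem_nhds ?_
    rw [hU.apply_self]
    exact P.isCoveringMap.continuous.continuousAt.preimage_mem_nhds hW
  obtain ⟨r, hr, hball⟩ := Metric.nhds_basis_closedBall.mem_iff.1 hsW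
  have hsc : ContinuousOn s (Metric.closedBall (D y₀) r) :=
    hU.continuousOn.mono fun u hu => (hball hu).2
  have hS : IsCompact (s '' Metric.sphere (D y₀) r) :=
    (isCompact_sphere _ _).image_of_continuousOn (hsc.mono Metric.sphere_subset_closedBall)
  have hjoint : Continuous fun p : L.Kstar P × P.Space => φ.Phi p.1.1 p.2 :=
    (hφ.isCont.continuous_Phi_uncurry hD q₀.1).comp
      ((continuous_subtype_val.comp continuous_fst).prodMk continuous_snd)
  -- For `q₀` the value at `y₀` lies strictly below all values on the small sphere. By compactness
  -- of the sphere this persists for nearby `q`.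
  have hev : ∀ᶠ q in 𝓝 q₀, ∀ z ∈ s '' Metric.sphere (D y₀) r, φ.Phi q.1 y₀ < φ.Phi q.1 z := by
    refine hS.eventually_forall_of_forall_eventually fun z hz => ?_
    have hlt : φ.Phi q₀.1 y₀ < φ.Phi q₀.1 z := by
      obtain ⟨u, hu, rfl⟩ := hz
      have hne : s u ≠ y₀ := by
        intro hcon
        have := hU.right_inv u (hball (Metric.sphere_subset_closedBall hu)).2
        rw [hcon] at this
        rw [← this, Metric.mem_sphere, dist_self] at hu
        exact hr.ne hu
      have h1 := h.pos y₀ _ hne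
      have h2 := h.apply_self y₀
      rw [hΦ] at h1 h2
      linarith
    exact ((hjoint.comp (continuous_fst.prodMk continuous_const)).continuousAt).eventually_lt
      hjoint.continuousAt hlt
  change ∀ᶠ q in 𝓝 q₀, φ.inverseDifferential (toMstar q) ∈ W
  filter_upwards [hev] with q hq
  obtain ⟨_, ⟨u, hu, rfl⟩, hmin⟩ :=
    ((isCompact_closedBall (D y₀) r).image_of_continuousOn hsc).exists_isMinOn
      ⟨s (D y₀), mem_image_of_mem s (Metric.mem_closedBall_self hr.le)⟩
      (hφ.isCont.continuous_Phi q.1).continuousOn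
  have hle : φ.Phi q.1 (s u) ≤ φ.Phi q.1 y₀ := by
    have := hmin (mem_image_of_mem s (Metric.mem_closedBall_self hr.le))
    rwa [hU.apply_self] at this
  -- Hence the minimum over the closed ball is interior, and so a local minimum of `Φ_q` on `Ω`.
  have hu' : u ∈ Metric.ball (D y₀) r := by
    refine Metric.mem_ball.2 (lt_of_le_of_ne (Metric.mem_closedBall.1 hu) fun hcon => ?_)
    exact absurd (hq _ (mem_image_of_mem s hcon)) (not_lt.2 hle)
  have hDu : D (s u) = u := hU.right_inv u (hball hu).2
  have hlocal : IsLocalMin (φ.Phi q.1) (s u) := by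
    have hsec : IsConvexSection D (s u) (Metric.ball (D y₀) r) s :=
      ⟨Metric.isOpen_ball, convex_ball _ _, by rwa [hDu], hsc.mono Metric.ball_subset_closedBall,
        by rw [hDu], fun v hv => hU.right_inv v (hball (Metric.ball_subset_closedBall hv)).2⟩
    filter_upwards [hsec.eventually_left_inv hlh,
      hlh.continuous.continuousAt.preimage_mem_nhds (hsec.isOpen.mem_nhds hsec.mem)] with z h1 h2
    exact hmin ⟨D z, Metric.ball_subset_closedBall h2, h1⟩
  -- A local minimum is enough: it makes a translate of `q` tangent there, and `T_φ` is known at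
  -- tangent sections.
  have htan : φ.IsTangentAt (φ.Phi q.1 (s u) +ᵥ q.1) (s u) := by
    rw [φ.isTangentAt_iff hD, φ.Phi_vadd]
    exact (hφ.locallyContDiff hD q.1).isLittleO_of_isLocalMin hlh hlocal
  rw [h.inverseDifferential_of_vadd_eq (C := φ.Phi q.1 (s u)) (y := s u)
    (Subtype.ext (h.unique _ _ htan))]
  exact (hball hu).1

end Sec.IsTangentFamily

end AffineRBundle

/-! ### Infima of real functions -/

section Infimum

variable {ι : Type*} [Nonempty ι] {F : ι → ℝ}

theorem ciSup_const_sub (hF : BddBelow (range F)) (c : ℝ) : ⨆ i, (c - F i) = c - ⨅ i, F i := by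
  obtain ⟨m, hm⟩ := hF
  have hb : BddAbove (range fun i => c - F i) :=
    ⟨c - m, by rintro _ ⟨i, rfl⟩; exact sub_le_sub_left (hm (mem_range_self i)) c⟩
  refine le_antisymm (ciSup_le fun i => sub_le_sub_left (ciInf_le ⟨m, hm⟩ i) c) ?_
  rw [sub_le_comm]
  exact le_ciInf fun i => by linarith [le_ciSup hb i]

theorem ciInf_add_const (hF : BddBelow (range F)) (c : ℝ) : ⨅ i, (F i + c) = (⨅ i, F i) + c := by
  obtain ⟨m, hm⟩ := hF
  have hb : BddBelow (range fun i => F i + c) :=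
    ⟨m + c, by rintro _ ⟨i, rfl⟩; exact add_le_add_left (hm (mem_range_self i)) c⟩
  refine le_antisymm ?_ (le_ciInf fun i => add_le_add_left (ciInf_le ⟨m, hm⟩ i) c)
  rw [← sub_le_iff_le_add]
  exact le_ciInf fun i => by linarith [ciInf_le hb i]

end Infimum

namespace AffineRBundle

variable {n : ℕ} {M : Type u} [TopologicalSpace M] [ChartedSpace (Coord n) M]
  {L : AffineRBundle.{u, v, w} n M} {P : UniversalCovering.{u, t} M}

/-! ### The cost function -/

theorem diff_neg {a b : L.Total} (hab : L.proj a = L.proj b) : L.diff b a = -L.diff a b := by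
  have hi := L.mem_base_indexAt (L.proj a)
  rw [L.diff_eq hab hi, L.diff_eq hab.symm (i := L.indexAt (L.proj a)) (by rw [← hab]; exact hi)]
  ring

/-- Since `(γ.q)(y) = φ(y) - Φ_q(γ⁻¹ y)`, the pairing is an infimum of `Φ_q` over an orbit, and the
Legendre transform is minus the infimum over `Ω`. Boundedness below keeps these real suprema and
infima from taking their default value. -/
theorem Sec.coverCost_eq (φ : L.Sec) {q : L.AffSec P} (hq : BddBelow (range (φ.Phi q)))
    (y : P.Space) :
    φ.coverCost y q = (⨅ γ : P.deck, φ.Phi q ((γ⁻¹ : P.deck).1 y)) - ⨅ z, φ.Phi q z := by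
  have hb : BddBelow (range fun γ : P.deck => φ.Phi q ((γ⁻¹ : P.deck).1 y)) :=
    hq.mono (by rintro _ ⟨γ, rfl⟩; exact mem_range_self _)
  have h1 : ∀ γ : P.deck, L.diff ((γ • q).toFun y) (q.toFun y)
      = φ.Phi q y - φ.Phi q ((γ⁻¹ : P.deck).1 y) := by
    intro γ
    have h2 : φ.Phi q ((γ⁻¹ : P.deck).1 y) = φ.Phi (γ • q) y := by rw [φ.Phi_smul]; rfl
    have h3 : φ.Phi (γ • q) y + L.diff ((γ • q).toFun y) (q.toFun y) = φ.Phi q y :=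
      L.diff_add_diff (by rw [φ.proj_toFun, (γ • q).proj_toFun])
        (by rw [(γ • q).proj_toFun, q.proj_toFun])
    rw [h2]
    linarith
  have h2 : L.diff (pairing y q) (φ.toFun (P.π y))
      = (⨆ γ : P.deck, L.diff ((γ • q).toFun y) (q.toFun y)) - φ.Phi q y := by
    have h3 : L.proj (q.toFun y) = L.proj (φ.toFun (P.π y)) := by rw [φ.proj_toFun, q.proj_toFun]
    rw [diff_neg (by rw [pairing, L.proj_vadd, h3]), pairing, L.diff_vadd_right h3.symm]
    exact neg_sub _ _
  have h3 : φ.legendre q = -⨅ z, φ.Phi q z := by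
    rw [← zero_sub, ← ciSup_const_sub hq]
    exact iSup_congr fun z => by
      rw [zero_sub]
      exact diff_neg (by rw [φ.proj_toFun, q.proj_toFun])
  rw [Sec.coverCost, h2, h3]
  simp only [h1]
  rw [ciSup_const_sub hb]
  ring

/-- The infimum of `Φ_q` over the fibre of `y`, for the affine section `q` tangent at `y'`. -/
def Sec.fiberGap (φ : L.Sec) (τ : P.Space → L.Kstar P) (y y' : P.Space) : ℝ :=
  ⨅ γ : P.deck, φ.Phi (τ y').1 ((γ⁻¹ : P.deck).1 y)

/-- The infimum of `Φ_q`, for the affine section `q` tangent at `y`. -/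
def Sec.tangentInf (φ₀ : L.Sec) (τ : P.Space → L.Kstar P) (y : P.Space) : ℝ :=
  ⨅ z, φ₀.Phi (τ y).1 z

/-- `fiberGap` as a function on `M × M`. -/
def Sec.gap (φ : L.Sec) (τ : P.Space → L.Kstar P) (p : M × M) : ℝ :=
  φ.fiberGap τ (Function.surjInv P.surjective p.1) (Function.surjInv P.surjective p.2)

/-- `tangentInf` as a function on `M`. -/
def Sec.baseInf (φ₀ : L.Sec) (τ : P.Space → L.Kstar P) (x : M) : ℝ :=
  φ₀.tangentInf τ (Function.surjInv P.surjective x)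

namespace Sec.IsTangentFamily

variable {φ φ₀ : L.Sec} {τ : P.Space → L.Kstar P}

theorem bddBelow_fiber (h : φ.IsTangentFamily τ) (y y' : P.Space) :
    BddBelow (range fun γ : P.deck => φ.Phi (τ y').1 ((γ⁻¹ : P.deck).1 y)) :=
  ⟨0, by rintro _ ⟨γ, rfl⟩; exact h.nonneg _ _⟩

theorem fiberGap_nonneg (h : φ.IsTangentFamily τ) (y y' : P.Space) : 0 ≤ φ.fiberGap τ y y' :=
  le_ciInf fun _ => h.nonneg _ _

theorem fiberGap_deck_left (γ₀ : P.deck) (y y' : P.Space) :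
    φ.fiberGap τ (γ₀.1 y) y' = φ.fiberGap τ y y' := by
  refine Equiv.iInf_congr (Equiv.mulLeft γ₀⁻¹) fun γ => ?_
  rw [Equiv.coe_mulLeft, mul_inv_rev, inv_inv]
  rfl

theorem fiberGap_deck_right (h : φ.IsTangentFamily τ) (γ₀ : P.deck) (y y' : P.Space) :
    φ.fiberGap τ y (γ₀.1 y') = φ.fiberGap τ y y' := by
  refine Equiv.iInf_congr (Equiv.mulRight γ₀) fun γ => ?_
  rw [Equiv.coe_mulRight, mul_inv_rev, h.Phi_deck]
  rfl

theorem le_tangentInf_term (h : φ.IsTangentFamily τ) {C : ℝ}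
    (hC : ∀ x, |L.diff (φ₀.toFun x) (φ.toFun x)| ≤ C) (y z : P.Space) :
    -C ≤ φ₀.Phi (τ y).1 z := by
  rw [φ₀.Phi_eq_add φ]
  linarith [h.nonneg y z, neg_le_of_abs_le (hC (P.π z))]

theorem bddBelow_Phi (h : φ.IsTangentFamily τ) {C : ℝ}
    (hC : ∀ x, |L.diff (φ₀.toFun x) (φ.toFun x)| ≤ C) (y : P.Space) :
    BddBelow (range (φ₀.Phi (τ y).1)) :=
  ⟨-C, by rintro _ ⟨z, rfl⟩; exact h.le_tangentInf_term hC y z⟩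

theorem abs_tangentInf_le (h : φ.IsTangentFamily τ) {C : ℝ}
    (hC : ∀ x, |L.diff (φ₀.toFun x) (φ.toFun x)| ≤ C) (y : P.Space) :
    |φ₀.tangentInf τ y| ≤ C := by
  refine abs_le.2 ⟨le_ciInf fun z => h.le_tangentInf_term hC y z,
    (ciInf_le (h.bddBelow_Phi hC y) y).trans ?_⟩
  rw [φ₀.Phi_eq_add φ, h.apply_self, add_zero]
  exact le_of_abs_le (hC _)

theorem tangentInf_deck (h : φ.IsTangentFamily τ) (γ : P.deck) (y : P.Space) :
    φ₀.tangentInf τ (γ.1 y) = φ₀.tangentInf τ y := by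
  refine Equiv.iInf_congr (γ⁻¹ : P.deck).1.toEquiv fun z => ?_
  rw [← h.smul_eq]
  exact (congrFun (φ₀.Phi_smul γ (τ y).1) z).symm

/-- On an orbit the difference `φ₀ - φ` is constant, so it leaves the infimum over `Π`, and `φ₀`
there can be replaced by `φ`. The normalizing constant `c` cancels between the two infima. -/
theorem coverCost_eq (h : φ.IsTangentFamily τ) {C : ℝ}
    (hC : ∀ x, |L.diff (φ₀.toFun x) (φ.toFun x)| ≤ C) (y : P.Space) {q : L.Kstar P} {c : ℝ}
    {y' : P.Space} (hq : c +ᵥ q = τ y') :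
    φ₀.coverCost y q.1 = φ.fiberGap τ y y' + L.diff (φ₀.toFun (P.π y)) (φ.toFun (P.π y))
      - φ₀.tangentInf τ y' := by
  have h1 : ∀ z, φ₀.Phi q.1 z = φ₀.Phi (τ y').1 z + c := fun z => by
    have := congrFun (φ₀.Phi_vadd c q.1) z
    rw [← hq]
    exact eq_add_of_sub_eq this.symm
  have hb : BddBelow (range (φ₀.Phi q.1)) := by
    obtain ⟨m, hm⟩ := h.bddBelow_Phi hC y'
    refine ⟨m + c, ?_⟩
    rintro _ ⟨z, rfl⟩
    rw [h1]
    exact add_le_add_left (hm (mem_range_self z)) c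
  have h2 : ∀ γ : P.deck, φ₀.Phi q.1 ((γ⁻¹ : P.deck).1 y) = φ.Phi (τ y').1 ((γ⁻¹ : P.deck).1 y)
      + (L.diff (φ₀.toFun (P.π y)) (φ.toFun (P.π y)) + c) := fun γ => by
    rw [h1, φ₀.Phi_eq_add φ, P.π_inv]
    ring
  rw [φ₀.coverCost_eq hb, iInf_congr h2, iInf_congr h1, ciInf_add_const (h.bddBelow_fiber y y'),
    ciInf_add_const (h.bddBelow_Phi hC y'), Sec.fiberGap, Sec.tangentInf]
  ring

theorem gap_nonneg (h : φ.IsTangentFamily τ) (p : M × M) : 0 ≤ φ.gap τ p := h.fiberGap_nonneg _ _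

variable [LocallyPathConnectedSpace P.Space]

theorem gap_π (h : φ.IsTangentFamily τ) (y y' : P.Space) :
    φ.gap τ (P.π y, P.π y') = φ.fiberGap τ y y' := by
  obtain ⟨γ, hγ⟩ := P.exists_deck (Function.surjInv_eq P.surjective (P.π y)).symm
  obtain ⟨γ', hγ'⟩ := P.exists_deck (Function.surjInv_eq P.surjective (P.π y')).symm
  rw [Sec.gap, ← hγ, ← hγ', fiberGap_deck_left, h.fiberGap_deck_right]

theorem baseInf_π (h : φ.IsTangentFamily τ) (y : P.Space) :
    φ₀.baseInf τ (P.π y) = φ₀.tangentInf τ y := by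
  obtain ⟨γ, hγ⟩ := P.exists_deck (Function.surjInv_eq P.surjective (P.π y)).symm
  rw [Sec.baseInf, ← hγ, h.tangentInf_deck]

/-- The infimum over a fibre cannot be approached without being attained: the fibre is closed, and
its part where `Φ_q ≤ 1` is compact. If it misses the zero of `Φ_q`, the values on it have a
positive minimum. -/
theorem gap_eq_zero_iff [T1Space M] [CompactSpace M] (h : φ.IsTangentFamily τ) (hφ : φ.IsCont)
    (x x' : M) : φ.gap τ (x, x') = 0 ↔ x = x' := by
  obtain ⟨y, rfl⟩ := P.surjective x
  obtain ⟨y', rfl⟩ := P.surjective x'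
  rw [h.gap_π]
  constructor
  · intro h0
    by_contra hne
    set S : Set P.Space := {z | φ.Phi (τ y').1 z ≤ 1} ∩ P.π ⁻¹' {P.π y} with hS
    have hSc : IsCompact S := (hφ.isCompact_sublevel (τ y') 1).inter_right
      (isClosed_singleton.preimage P.isCoveringMap.continuous)
    obtain ⟨m, hm, hmS⟩ : ∃ m > 0, ∀ z ∈ S, m ≤ φ.Phi (τ y').1 z := by
      rcases S.eq_empty_or_nonempty with he | hn
      · exact ⟨1, one_pos, by simp [he]⟩
      · obtain ⟨z, hz, hmin⟩ := hSc.exists_isMinOn hn (hφ.continuous_Phi _).continuousOn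
        refine ⟨_, h.pos y' z ?_, fun w hw => hmin hw⟩
        rintro rfl
        exact hne hz.2.symm
    have hle : min m 1 ≤ φ.fiberGap τ y y' := by
      refine le_ciInf fun γ => ?_
      rcases le_total (φ.Phi (τ y').1 ((γ⁻¹ : P.deck).1 y)) 1 with h1 | h1
      · exact (min_le_left _ _).trans (hmS _ ⟨h1, P.π_inv γ y⟩)
      · exact (min_le_right _ _).trans h1
    rw [h0] at hle
    exact absurd hle (not_le.2 (lt_min hm one_pos))
  · intro hyy
    obtain ⟨γ, rfl⟩ := P.exists_deck hyy
    refine le_antisymm ((ciInf_le (h.bddBelow_fiber _ _) γ⁻¹).trans ?_) (h.fiberGap_nonneg _ _)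
    rw [inv_inv, h.apply_self]

/-- Near `(x, x')` the gap lies below a single continuous term of the infimum, and `π` maps
neighbourhoods onto neighbourhoods. Upper semicontinuity yields both measurability and an upper
bound on the compact `M × M`. -/
theorem upperSemicontinuous_gap (h : φ.IsTangentFamily τ) : UpperSemicontinuous (φ.gap τ) := by
  rintro ⟨x, x'⟩ r hr
  obtain ⟨y, rfl⟩ := P.surjective x
  obtain ⟨y', rfl⟩ := P.surjective x'
  rw [h.gap_π] at hr
  obtain ⟨γ, hγ⟩ := exists_lt_of_ciInf_lt hr
  have h1 : Continuous fun p : P.Space × P.Space => φ.Phi (τ p.2).1 ((γ⁻¹ : P.deck).1 p.1) :=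
    h.continuous_Phi.comp (continuous_snd.prodMk ((γ⁻¹ : P.deck).1.continuous.comp continuous_fst))
  rw [nhds_prod_eq, ← P.map_nhds_π, ← P.map_nhds_π, Filter.prod_map_map_eq, ← nhds_prod_eq,
    eventually_map]
  filter_upwards [h1.continuousAt.eventually_lt_const hγ] with p hp
  rw [h.gap_π]
  exact (ciInf_le (h.bddBelow_fiber _ _) γ).trans_lt hp

theorem upperSemicontinuous_baseInf (h : φ.IsTangentFamily τ) {C : ℝ}
    (hC : ∀ x, |L.diff (φ₀.toFun x) (φ.toFun x)| ≤ C) :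
    UpperSemicontinuous (φ₀.baseInf τ) := by
  intro x r hr
  obtain ⟨y, rfl⟩ := P.surjective x
  rw [h.baseInf_π] at hr
  obtain ⟨z, hz⟩ := exists_lt_of_ciInf_lt hr
  have h1 : Continuous fun y => φ₀.Phi (τ y).1 z := by
    simp only [φ₀.Phi_eq_add φ]
    exact continuous_const.add (h.continuous_Phi.comp (continuous_id.prodMk continuous_const))
  rw [← P.map_nhds_π, eventually_map]
  filter_upwards [h1.continuousAt.eventually_lt_const hz] with y hy
  rw [h.baseInf_π]
  exact (ciInf_le (h.bddBelow_Phi hC _) z).trans_lt hy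

theorem cost_eq (h : φ.IsTangentFamily τ) {C : ℝ}
    (hC : ∀ x, |L.diff (φ₀.toFun x) (φ.toFun x)| ≤ C) (x : M) (p : L.Mstar P) :
    φ₀.cost x p = φ.gap τ (x, φ.inverseDifferential p) + L.diff (φ₀.toFun x) (φ.toFun x)
      + -φ₀.baseInf τ (φ.inverseDifferential p) := by
  have hp : toMstar (Function.surjInv toMstar_surjective p) = p := Function.surjInv_eq _ p
  set q := Function.surjInv toMstar_surjective p with hq
  obtain ⟨c, y', hc⟩ := h.exists_vadd_eq q
  have hy' : φ.inverseDifferential p = P.π y' := by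
    rw [← hp]
    exact h.inverseDifferential_of_vadd_eq hc
  obtain ⟨y, hy⟩ : ∃ y, Function.surjInv P.surjective x = y := ⟨_, rfl⟩
  have hyx : P.π y = x := by rw [← hy]; exact Function.surjInv_eq _ _
  have h1 := h.coverCost_eq hC y hc
  rw [hy', Sec.cost, ← hq, hy, h1, h.baseInf_π, ← hyx, h.gap_π, sub_eq_add_neg]

end Sec.IsTangentFamily

end AffineRBundle

/-! ### Optimal transport -/

section OptimalTransport

variable {X : Type u} {Y : Type v} [MeasurableSpace X] [MeasurableSpace Y] {μ : Measure X}
  {ν : Measure Y}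

theorem IsTransportPlan.integrable_fst {ρ : Measure (X × Y)} (hρ : IsTransportPlan μ ν ρ) {g : X → ℝ}
    (hg : Integrable g μ) : Integrable (fun z : X × Y => g z.1) ρ := by
  rw [← hρ.2.1] at hg
  exact hg.comp_measurable measurable_fst

theorem IsTransportPlan.integrable_snd {ρ : Measure (X × Y)} (hρ : IsTransportPlan μ ν ρ) {g : Y → ℝ}
    (hg : Integrable g ν) : Integrable (fun z : X × Y => g z.2) ρ := by
  rw [← hρ.2.2] at hg
  exact hg.comp_measurable measurable_snd

theorem IsTransportPlan.integral_fst {ρ : Measure (X × Y)} (hρ : IsTransportPlan μ ν ρ) {g : X → ℝ}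
    (hg : Integrable g μ) : ∫ z, g z.1 ∂ρ = ∫ x, g x ∂μ := by
  rw [← hρ.2.1] at hg ⊢
  exact (integral_map measurable_fst.aemeasurable hg.aestronglyMeasurable).symm

theorem IsTransportPlan.integral_snd {ρ : Measure (X × Y)} (hρ : IsTransportPlan μ ν ρ) {g : Y → ℝ}
    (hg : Integrable g ν) : ∫ z, g z.2 ∂ρ = ∫ y, g y ∂ν := by
  rw [← hρ.2.2] at hg ⊢
  exact (integral_map measurable_snd.aemeasurable hg.aestronglyMeasurable).symm

/-- A map whose graph is the zero set of a nonnegative function, which differs from the cost by a sum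
of two potentials, is an optimal transport map. -/
theorem isOptimalTransportMap_of_potentials [IsProbabilityMeasure μ] {c k : X → Y → ℝ} {g : X → ℝ}
    {h : Y → ℝ} {T : X → Y} (hT : Measurable T) (hTν : μ.map T = ν)
    (hc : ∀ x y, c x y = k x y + g x + h y) (hk : ∀ x y, 0 ≤ k x y)
    (hk₀ : ∀ x y, k x y = 0 ↔ T x = y) (hg : Integrable g μ) (hh : Integrable h ν)
    (hki : ∀ ρ, IsTransportPlan μ ν ρ → Integrable (fun z : X × Y => k z.1 z.2) ρ) :
    IsOptimalTransportMap c μ ν T := by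
  have hgraph : Measurable fun x => (x, T x) := measurable_id.prodMk hT
  have hplan : IsTransportPlan μ ν (μ.map fun x => (x, T x)) := by
    refine ⟨Measure.isProbabilityMeasure_map hgraph.aemeasurable, ?_, ?_⟩
    · rw [Measure.map_map measurable_fst hgraph]
      exact Measure.map_id
    · rw [Measure.map_map measurable_snd hgraph]
      exact hTν
  -- The potentials contribute the same amount for every plan, so only the integral of `k` is to be
  -- minimized.
  have hint : ∀ ρ, IsTransportPlan μ ν ρ →
      ∫ z, c z.1 z.2 ∂ρ = ∫ z, k z.1 z.2 ∂ρ + ∫ x, g x ∂μ + ∫ y, h y ∂ν := by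
    intro ρ hρ
    have hkg : Integrable (fun z : X × Y => k z.1 z.2 + g z.1) ρ :=
      (hki ρ hρ).add (hρ.integrable_fst hg)
    simp only [hc]
    rw [integral_add hkg (hρ.integrable_snd hh),
      integral_add (hki ρ hρ) (hρ.integrable_fst hg), hρ.integral_fst hg, hρ.integral_snd hh]
  have hzero : ∫ z, k z.1 z.2 ∂(μ.map fun x => (x, T x)) = 0 := by
    rw [integral_map hgraph.aemeasurable (hki _ hplan).aestronglyMeasurable]
    simp [(hk₀ _ _).2 rfl]
  refine ⟨hT, fun ρ hρ => ?_, ⟨hplan, fun ρ hρ => ?_⟩, fun ρ hρ => ?_⟩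
  · simp only [hc]
    exact ((hki ρ hρ).add (hρ.integrable_fst hg)).add (hρ.integrable_snd hh)
  · rw [hint _ hplan, hint ρ hρ, hzero]
    linarith [integral_nonneg (μ := ρ) (f := fun z : X × Y => k z.1 z.2) fun z => hk _ _]
  · have hle := hρ.2 _ hplan
    rw [hint _ hplan, hint ρ hρ.1, hzero] at hle
    have hnonneg : 0 ≤ fun z : X × Y => k z.1 z.2 := fun z => hk _ _
    have h0 : ∫ z, k z.1 z.2 ∂ρ = 0 := le_antisymm (by linarith) (integral_nonneg hnonneg)
    rw [integral_eq_zero_iff_of_nonneg hnonneg (hki ρ hρ.1)] at h0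
    -- A nonnegative function with zero integral vanishes almost everywhere, so `ρ` is carried by
    -- the graph of `T` and is the image of its first marginal.
    have hae : (fun z : X × Y => z) =ᵐ[ρ] fun z => (z.1, T z.1) := by
      filter_upwards [h0] with z hz
      exact Prod.ext rfl ((hk₀ _ _).1 hz).symm
    calc ρ = ρ.map fun z => z := Measure.map_id.symm
      _ = ρ.map fun z => (z.1, T z.1) := Measure.map_congr hae
      _ = (ρ.map Prod.fst).map fun x => (x, T x) := (Measure.map_map hgraph measurable_fst).symm
      _ = μ.map fun x => (x, T x) := by rw [hρ.1.2.1]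

end OptimalTransport

end HessianTransport

end

/-! ### Assembly of the theorem. -/

open HessianTransport
theorem theorem1p3 {n : ℕ} {M : Type*} [TopologicalSpace M] [T2Space M] [CompactSpace M]
    [ConnectedSpace M] [ChartedSpace (Coord n) M] [IsAffineManifold n M]
    [MeasurableSpace M] [BorelSpace M]
    (L : AffineRBundle n M) (hL : L.IsHessian) (P : UniversalCovering M)
    (μ : Measure M) [IsProbabilityMeasure μ]
    (ν : Measure (L.Mstar P)) [IsProbabilityMeasure ν]
    (φ₀ : L.Sec) (hφ₀ : φ₀.IsConvex)
    (φ : L.Sec) (hsmooth : φ.IsSmooth) (hconvex : φ.IsStrictConvex)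
    (hMA : φ.mongeAmpere ν = μ) :
    ∃ T : M → L.Mstar P,
      (∀ x p, φ.IsDifferentialAt x p ↔ T x = p) ∧
        IsOptimalTransportMap φ₀.cost μ ν T := by
  have := P.locallyPathConnectedSpace n
  -- Makes the product σ-algebra on `M × M` the Borel one, so that semicontinuous functions there
  -- are measurable.
  have : SecondCountableTopology M := ChartedSpace.secondCountable_of_sigmaCompact (Coord n) M
  obtain ⟨τ, hτ⟩ := hsmooth.exists_isTangentFamily hL P hconvex
  obtain ⟨C, hC⟩ := hφ₀.isCont.exists_bound hsmooth.isCont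
  have hTm : Measurable (AffineRBundle.dualMap τ) := hτ.continuous_dualMap.measurable
  obtain ⟨D, hD⟩ := L.exists_isDeveloping P
  have hS : Measurable φ.inverseDifferential :=
    (hτ.continuous_inverseDifferential hsmooth hD).measurable
  have hTν : μ.map (AffineRBundle.dualMap τ) = ν := by
    have hcomp : AffineRBundle.dualMap τ ∘ φ.inverseDifferential = id :=
      funext hτ.dualMap_inverseDifferential
    rw [← hMA, AffineRBundle.Sec.mongeAmpere, Measure.map_map hTm hS, hcomp, Measure.map_id]
  -- The potentials are `φ₀ - φ` on `M` and `-baseInf ∘ T_φ` on `M*`. Both are bounded by `C`.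
  refine ⟨AffineRBundle.dualMap τ, hτ.isDifferentialAt_iff,
    isOptimalTransportMap_of_potentials (k := fun x p => φ.gap τ (x, φ.inverseDifferential p))
      hTm hTν (hτ.cost_eq hC) (fun x p => hτ.gap_nonneg _) (fun x p => ?_) ?_ ?_ fun ρ hρ => ?_⟩
  · rw [hτ.gap_eq_zero_iff hsmooth.isCont]
    constructor
    · rintro rfl
      exact hτ.dualMap_inverseDifferential p
    · rintro rfl
      exact (hτ.inverseDifferential_dualMap x).symm
  · exact Integrable.of_bound
      (hφ₀.isCont.continuous_diff hsmooth.isCont).measurable.aestronglyMeasurable C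
      (Eventually.of_forall hC)
  · refine Integrable.neg (Integrable.of_bound (C := C) ?_ (Eventually.of_forall fun p => ?_))
    · exact ((hτ.upperSemicontinuous_baseInf hC).measurable.comp hS).aestronglyMeasurable
    · exact hτ.abs_tangentInf_le hC _
  · have := hρ.1
    obtain ⟨B, hB⟩ := UpperSemicontinuousOn.bddAbove_of_isCompact isCompact_univ
      (hτ.upperSemicontinuous_gap.upperSemicontinuousOn univ)
    have hS' : Measurable fun z : M × L.Mstar P => (z.1, φ.inverseDifferential z.2) :=
      measurable_fst.prodMk (hS.comp measurable_snd)
    refine Integrable.of_bound (hτ.upperSemicontinuous_gap.measurable.comp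
      hS').aestronglyMeasurable B (Eventually.of_forall fun z => ?_)
    change ‖φ.gap τ (z.1, φ.inverseDifferential z.2)‖ ≤ B
    rw [Real.norm_eq_abs, abs_of_nonneg (hτ.gap_nonneg _)]
    exact hB (mem_image_of_mem _ (mem_univ _))
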